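/- Consider the Poincaré patch of AdS$_3$ with metric $(-dT^2+dZ^2+dX^2)/Z^2$, $Z>0$; fix a bulk point $(T',X',Z')$, $Z'>0$, and let $(T,X)\in\mathbb R^2$ denote a boundary point. Put $\Delta T=T'-T$, $\Delta X=X'-X$ and $k^2=-\omega^2+k_X^2$. For real $\mu>-1$ let $$m_\mu(\omega,k_X)=2^{\mu}\,\Gamma(1+\mu)\,(\omega^2-k_X^2)^{-\mu/2}\,Z'J_{\mu}\!\big(\sqrt{-k^2}\,Z'\big),$$ where $J_\mu$ is the Bessel function of the first kind; for spacelike momenta $\omega^2<k_X^2$ the expression is understood by analytic continuation in $k^2$ (equivalently, with principal branches). For $\nu\ge 0$ the Dirichlet kernel is the Fourier integral with symbol $m=m_\nu$, and for $0<\nu<1$ and $\gamma\in\mathbb R$ the Robin kernel is the one with symbol $m=\cos\gamma\; m_\nu+\sin\gamma\; m_{-\nu}$: $$K(T,X|T',X',Z')=\int_{\mathbb R^2}\frac{d\omega\,dk_X}{(2\pi)^2}\;e^{-i\omega\Delta T+ik_X\Delta X}\,m(\omega,k_X).$$ Since $m$ grows exponentially in spacelike directions, $K$ is a generalized function: for a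 Schwartz function $f$ on $\mathbb R^2$ put $\tilde f(\omega,k_X)=\int e^{-i\omega\Delta T+ik_X\Delta X}f(T,X)\,dT\,dX$ and $$K[f]=\frac1{(2\pi)^2}\int_{\mathbb R}dk_X\int_{\mathbb R}d\omega\; m(\omega,k_X)\,\tilde f(\omega,k_X).$$ We say that $f$ is in the domain of $K$ if the $\omega$-integral converges absolutely for every $k_X$ and its value is absolutely integrable in $k_X$. We say that $K$ has the value $c$ at the point $(T,X)$ if for every $k_X$ the limit $g(k_X)=\lim_{R\to\infty}\int_{-R}^{R}e^{-i\omega\Delta T+ik_X\Delta X}m(\omega,k_X)\,d\omega$ exists, $g$ is integrable, and $(2\pi)^{-2}\int g\,dk_X=c$. Then, for the Dirichlet kernel ($\nu\ge0$) and for the Robin kernel ($0<\nu<1$): 1. (Definedness.) If $f$ is Schwartz and, for some $B\in\mathbb{R}$, $\tilde f(\omega,k_X)=0$ whenever $k_X^2-\omega^2>B$ (for instance if $f$ has only causal momenta, or bounded $k_X$), then $f$ is in the domain of $K$ and $m\tilde f$ is absolutely integrable on $\mathbb R^2$. 2. (Reality.) $K[f]\in\mathbb R$ for every real-valued $f$ in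 the domain, and every value of $K$ at a point, where it exists, is real. 3. (Spacelike support.) There is an open set $U\subseteq\mathbb R^2$ that contains all boundary points that are timelike separated from the bulk point, $\Delta X^2+Z'^2-\Delta T^2<0$, and all lightlike separated ones, $\Delta X^2+Z'^2-\Delta T^2=0$, with $\Delta X\ne0$, such that $K$ vanishes on $U$: every Schwartz function $f$ whose support is contained in $U$ is in the domain of $K$ and satisfies $K[f]=0$. 4. (Pointwise vanishing.) For the Dirichlet kernel ($\nu\ge 0$), and for the Robin kernel when $\nu<1/2$, $K$ has the value $0$ at every boundary point that is timelike separated, or lightlike separated with $\Delta X\ne 0$, from the bulk point. -/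

import Mathlib

open scoped SchwartzMap
open MeasureTheory Filter Topology

noncomputable section

/-- The Bessel function of the first kind `J_μ(z)`, real order `μ`, principal branch in `z`.
(`1 / Γ` vanishes at the poles of `Γ`, in agreement with Lean's `x / 0 = 0`.) -/
def besselJ (μ : ℝ) (z : ℂ) : ℂ :=
  (z / 2) ^ (μ : ℂ) *
    ∑' n : ℕ, ((-1 : ℂ) ^ n / ((n.factorial : ℂ) * Complex.Gamma ((n : ℂ) + (μ : ℂ) + 1))) *
      (z / 2) ^ (2 * n)

/-- `-k² = ω² - k_X²`, as a complex number. -/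
def negMomentumSq (ω k : ℝ) : ℂ := (ω : ℂ) ^ 2 - (k : ℂ) ^ 2

/-- The radial mode `Z J_μ(√(-k²) Z)` of the Klein–Gordon equation on the Poincaré patch of AdS₃,
at momentum `(ω, k_X)`. -/
def radialMode (μ Z ω k : ℝ) : ℂ :=
  (Z : ℂ) * besselJ μ (negMomentumSq ω k ^ (1 / 2 : ℂ) * (Z : ℂ))

/-- The momentum-space kernel `2^μ Γ(1 + μ) (ω² - k_X²)^(-μ/2) Z J_μ(√(-k²) Z)`, for all real
momenta, spacelike ones included. For `ω² < k_X²` the principal branches of the two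
powers are used; off the null set `ω² = k_X²` this is the entire function of `ω² - k_X²`
that continues the expression from timelike momenta. -/
def modeSymbol (μ Z ω k : ℝ) : ℂ :=
  (2 : ℂ) ^ (μ : ℂ) * Complex.Gamma (1 + (μ : ℂ)) *
    negMomentumSq ω k ^ (-(μ : ℂ) / 2) * radialMode μ Z ω k

/-- Momentum-space Dirichlet kernel, `Δ₊ = 1 + ν`. -/
def dirichletSymbol (ν Z ω k : ℝ) : ℂ := modeSymbol ν Z ω k

/-- Momentum-space Neumann kernel, obtained by `ν ↦ -ν`, so `Δ₋ = 1 - ν`. -/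
def neumannSymbol (ν Z ω k : ℝ) : ℂ := modeSymbol (-ν) Z ω k

/-- Momentum-space Robin kernel with boundary-condition parameter `γ`. -/
def robinSymbol (ν γ Z ω k : ℝ) : ℂ :=
  (Real.cos γ : ℂ) * dirichletSymbol ν Z ω k + (Real.sin γ : ℂ) * neumannSymbol ν Z ω k

/-- The plane wave `exp(-iω(T' - T) + i k_X (X' - X))`; the boundary point is `p = (T, X)`. -/
def planeWave (T' X' ω k : ℝ) (p : ℝ × ℝ) : ℂ :=
  Complex.exp (-Complex.I * ω * (T' - p.1) + Complex.I * k * (X' - p.2))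

/-- The test function `f` integrated against the plane wave of momentum `(ω, k_X)`. -/
def waveTransform (T' X' : ℝ) (f : 𝓢(ℝ × ℝ, ℂ)) (ω k : ℝ) : ℂ :=
  ∫ p : ℝ × ℝ, planeWave T' X' ω k p * f p

/-- The kernel with symbol `m` can be applied to the test function `f`: the momentum integral,
with the `ω`-integral done first, converges absolutely at each of its two steps. -/
def InKernelDomain (m : ℝ → ℝ → ℂ) (T' X' : ℝ) (f : 𝓢(ℝ × ℝ, ℂ)) : Prop :=
  (∀ k : ℝ, Integrable (fun ω : ℝ => m ω k * waveTransform T' X' f ω k)) ∧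
    Integrable (fun k : ℝ => ∫ ω : ℝ, m ω k * waveTransform T' X' f ω k)

/-- `∫ K(T,X|T',X',Z') f(T,X) dT dX`, for the generalized function
`K = ∫ dω dk_X / (2π)² exp(-iω(T' - T) + i k_X (X' - X)) m(ω, k_X)`. -/
def kernelPairing (m : ℝ → ℝ → ℂ) (T' X' : ℝ) (f : 𝓢(ℝ × ℝ, ℂ)) : ℂ :=
  (1 / (2 * Real.pi) ^ 2 : ℝ) * ∫ k : ℝ, ∫ ω : ℝ, m ω k * waveTransform T' X' f ω k

/-- The value at the boundary point `p` of the Fourier integral `K` exists and equals `c`: the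
improper `ω`-integral converges for every `k_X`, and the result is integrable in `k_X`. -/
def HasKernelValue (m : ℝ → ℝ → ℂ) (T' X' : ℝ) (p : ℝ × ℝ) (c : ℂ) : Prop :=
  ∃ g : ℝ → ℂ,
    (∀ k : ℝ, Tendsto (fun R : ℝ => ∫ ω in (-R)..R, planeWave T' X' ω k p * m ω k)
      atTop (𝓝 (g k))) ∧
    Integrable g ∧ (1 / (2 * Real.pi) ^ 2 : ℝ) * ∫ k : ℝ, g k = c

/-- `K` is defined, by an absolutely convergent integral over all momenta, on all Schwartz
functions whose spacelike momenta are bounded in invariant size. These include the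
functions with only causal momenta and those with bounded `k_X`. -/
def IsDefinedKernel (m : ℝ → ℝ → ℂ) (T' X' : ℝ) : Prop :=
  ∀ f : 𝓢(ℝ × ℝ, ℂ), ∀ B : ℝ,
    (∀ ω k : ℝ, B < k ^ 2 - ω ^ 2 → waveTransform T' X' f ω k = 0) →
      InKernelDomain m T' X' f ∧
        Integrable (fun q : ℝ × ℝ => m q.1 q.2 * waveTransform T' X' f q.1 q.2)

/-- `K` is real: it takes real values on real test functions, and its point values, where they
exist, are real. -/
def IsRealKernel (m : ℝ → ℝ → ℂ) (T' X' : ℝ) : Prop :=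
  (∀ f : 𝓢(ℝ × ℝ, ℂ), InKernelDomain m T' X' f → (∀ p, (f p).im = 0) →
    (kernelPairing m T' X' f).im = 0) ∧
  ∀ (p : ℝ × ℝ) (c : ℂ), HasKernelValue m T' X' p c → c.im = 0

/-- `K` vanishes on the set `U` of boundary points, as a generalized function. -/
def KernelVanishesOn (m : ℝ → ℝ → ℂ) (T' X' : ℝ) (U : Set (ℝ × ℝ)) : Prop :=
  ∀ f : 𝓢(ℝ × ℝ, ℂ), tsupport (f : ℝ × ℝ → ℂ) ⊆ U →
    InKernelDomain m T' X' f ∧ kernelPairing m T' X' f = 0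

/-- `lim_{Z → 0} 2 Z Z' σ = ΔX² + Z'² - ΔT²`, for the invariant distance `σ` of the bulk point
`(T', X', Z')` and the point `(T, X, Z)` that tends to the boundary point `p = (T, X)`. -/
def boundaryInterval (T' X' Z' : ℝ) (p : ℝ × ℝ) : ℝ :=
  (X' - p.2) ^ 2 + Z' ^ 2 - (T' - p.1) ^ 2

/-- Boundary points timelike separated from the bulk point. -/
def timelikeRegion (T' X' Z' : ℝ) : Set (ℝ × ℝ) := {p | boundaryInterval T' X' Z' p < 0}

/-- Boundary points lightlike separated from the bulk point, other than the two
with `ΔX = 0`. -/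
def lightlikeRegion (T' X' Z' : ℝ) : Set (ℝ × ℝ) :=
  {p | boundaryInterval T' X' Z' p = 0 ∧ p.2 ≠ X'}

/-- `K` has spacelike support: it vanishes on an open set that contains all boundary points that are
timelike, or lightlike with `ΔX ≠ 0`, from the bulk point. -/
def HasSpacelikeSupport (m : ℝ → ℝ → ℂ) (T' X' Z' : ℝ) : Prop :=
  ∃ U : Set (ℝ × ℝ), IsOpen U ∧ timelikeRegion T' X' Z' ∪ lightlikeRegion T' X' Z' ⊆ U ∧
    KernelVanishesOn m T' X' U

/-- At each of these boundary points the Fourier integral converges, with value `0`. -/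
def VanishesPointwise (m : ℝ → ℝ → ℂ) (T' X' Z' : ℝ) : Prop :=
  ∀ p ∈ timelikeRegion T' X' Z' ∪ lightlikeRegion T' X' Z', HasKernelValue m T' X' p 0

end

/-!
In terms of the Bessel–Clifford function `C_a`, `J_μ(z) = (z / 2) ^ μ * C_{μ + 1}(-z² / 4)`, so the
branch cuts cancel and `m_μ` is an entire function of `k_X² - ω²`. For `μ > -1/2`, Poisson's
integral in the form due to Sonine exhibits it, at fixed `k_X`, as the Fourier transform in `ω` of
an integrable function supported in `|t| ≤ Z'`. The recurrence
`C_a(x) = a C_{a + 1}(x) + x C_{a + 2}(x)` extends this to `μ > -1`, up to a factor `ω²` that a test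
function absorbs. Hence for each `k_X` the kernel lives on `|ΔT| ≤ Z'`, whereas `|ΔT| > Z'` at a
timelike point and at a lightlike one with `ΔX ≠ 0`. Reality holds because `m` is real and even,
while `(ω, k_X) ↦ (-ω, -k_X)` conjugates the Fourier transform of a real `f`.
-/

noncomputable section

open scoped FourierTransform

/-! ### Bessel–Clifford functions -/

/-- The Bessel–Clifford function `∑ xⁿ / (n! Γ(a + n))`, an entire function of `x` in terms of which
`J_μ(z) = (z / 2) ^ μ * besselClifford (μ + 1) (-z² / 4)`. -/
def besselClifford (a x : ℝ) : ℝ := ∑' n : ℕ, x ^ n / (n.factorial * Real.Gamma (a + n))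

theorem exists_pos_le_Gamma_add_nat {a : ℝ} (ha : 0 < a) :
    ∃ c : ℝ, 0 < c ∧ ∀ n : ℕ, c ≤ Real.Gamma (a + n) := by
  refine ⟨min (min (Real.Gamma a) (Real.Gamma (a + 1))) 1,
    lt_min (lt_min (Real.Gamma_pos_of_pos ha) (Real.Gamma_pos_of_pos (by positivity))) one_pos,
    fun n => ?_⟩
  match n with
  | 0 => simp
  | 1 => simp
  | n + 2 =>
    have two_le : 2 ≤ a + (n + 2 : ℕ) := by push_cast; linarith [n.cast_nonneg (α := ℝ)]
    calc _ ≤ 1 := min_le_right _ _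
      _ = Real.Gamma 2 := Real.Gamma_two.symm
      _ ≤ _ := Real.Gamma_strictMonoOn_Ici.monotoneOn Set.self_mem_Ici two_le two_le

theorem summable_norm_besselClifford {a : ℝ} (ha : 0 < a) (x : ℝ) :
    Summable fun n : ℕ => ‖x ^ n / (n.factorial * Real.Gamma (a + n))‖ := by
  obtain ⟨c, hc, hcΓ⟩ := exists_pos_le_Gamma_add_nat ha
  refine .of_nonneg_of_le (fun n => norm_nonneg _) (fun n => ?_)
    ((Real.summable_pow_div_factorial |x|).mul_left c⁻¹)
  have := hcΓ n
  rw [norm_div, norm_pow, Real.norm_eq_abs, Real.norm_of_nonneg (by positivity), inv_mul_eq_div,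
    div_div]
  gcongr

theorem hasSum_besselClifford {a : ℝ} (ha : 0 < a) (x : ℝ) :
    HasSum (fun n : ℕ => x ^ n / (n.factorial * Real.Gamma (a + n))) (besselClifford a x) :=
  (summable_norm_besselClifford ha x).of_norm.hasSum

theorem continuous_besselClifford {a : ℝ} (ha : 0 < a) : Continuous (besselClifford a) := by
  refine continuous_iff_continuousAt.2 fun x => ?_
  have continuousOn_ball : ContinuousOn (besselClifford a) (Metric.ball 0 (|x| + 1)) := by
    refine continuousOn_tsum (fun n => by fun_prop)
      (summable_norm_besselClifford ha (|x| + 1)) fun n y hy => ?_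
    rw [mem_ball_zero_iff, Real.norm_eq_abs] at hy
    have : |y| ≤ |(|x| + 1)| := hy.le.trans (le_abs_self _)
    simp only [norm_div, norm_pow, Real.norm_eq_abs]
    gcongr
  exact continuousOn_ball.continuousAt (Metric.isOpen_ball.mem_nhds (by simp))

theorem besselClifford_term_recurrence {a : ℝ} (ha : 0 < a) (x : ℝ) (n : ℕ) :
    x ^ (n + 1) / ((n + 1).factorial * Real.Gamma (a + (n + 1 : ℕ))) =
      a * (x ^ (n + 1) / ((n + 1).factorial * Real.Gamma (a + 1 + (n + 1 : ℕ)))) +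
        x * (x ^ n / (n.factorial * Real.Gamma (a + 2 + n))) := by
  have Gamma_step : Real.Gamma (a + (n + 1) + 1) = (a + (n + 1)) * Real.Gamma (a + (n + 1)) :=
    Real.Gamma_add_one (by positivity)
  have Gamma_ne_zero : Real.Gamma (a + (n + 1)) ≠ 0 := (Real.Gamma_pos_of_pos (by positivity)).ne'
  have add_ne_zero : a + (n + 1) ≠ 0 := by positivity
  push_cast [Nat.factorial_succ]
  rw [show a + 1 + ((n : ℝ) + 1) = a + (n + 1) + 1 by ring,
    show a + 2 + (n : ℝ) = a + (n + 1) + 1 by ring, Gamma_step]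
  field_simp
  ring

theorem besselClifford_recurrence {a : ℝ} (ha : 0 < a) (x : ℝ) :
    besselClifford a x = a * besselClifford (a + 1) x + x * besselClifford (a + 2) x := by
  have tail := (hasSum_nat_add_iff' 1).2 (hasSum_besselClifford ha x)
  have tail_add_one := ((hasSum_nat_add_iff' 1).2
    (hasSum_besselClifford (a := a + 1) (by positivity) x)).mul_left a
  have series_add_two := (hasSum_besselClifford (a := a + 2) (by positivity) x).mul_left x
  simp only [besselClifford_term_recurrence ha] at tail
  have tail_eq := tail.unique (tail_add_one.add series_add_two)
  simp only [Finset.sum_range_one, pow_zero, Nat.factorial_zero, Nat.cast_one, one_mul,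
    Nat.cast_zero, add_zero] at tail_eq
  have head_eq : 1 / Real.Gamma a = a * (1 / Real.Gamma (a + 1)) := by
    rw [Real.Gamma_add_one ha.ne', mul_one_div, div_mul_cancel_left₀ ha.ne', one_div]
  linear_combination tail_eq + head_eq

theorem summable_norm_besselClifford_add {a : ℝ} (ha : 0 < a) (x y : ℝ) :
    Summable fun p : ℕ × ℕ => ‖x ^ p.1 * y ^ p.2 /
      (p.1.factorial * p.2.factorial * Real.Gamma (a + (p.1 + p.2 : ℕ)))‖ := by
  obtain ⟨c, hc, hcΓ⟩ := exists_pos_le_Gamma_add_nat ha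
  refine .of_nonneg_of_le (fun _ => norm_nonneg _) (fun p => ?_)
    (((Real.summable_pow_div_factorial |x|).mul_of_nonneg (Real.summable_pow_div_factorial |y|)
      (fun n => by positivity) (fun n => by positivity)).mul_left c⁻¹)
  have := hcΓ (p.1 + p.2)
  calc _ = |x| ^ p.1 * |y| ^ p.2 /
        (p.1.factorial * p.2.factorial * Real.Gamma (a + (p.1 + p.2 : ℕ))) := by
        rw [norm_div, norm_mul, norm_pow, norm_pow, Real.norm_eq_abs, Real.norm_eq_abs,
          Real.norm_of_nonneg (by positivity)]
    _ ≤ |x| ^ p.1 * |y| ^ p.2 / (p.1.factorial * p.2.factorial * c) := by gcongr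
    _ = c⁻¹ * (|x| ^ p.1 / p.1.factorial * (|y| ^ p.2 / p.2.factorial)) := by field_simp

theorem sum_antidiagonal_pow_div_factorial (x y : ℝ) (n : ℕ) :
    ∑ p ∈ Finset.HasAntidiagonal.antidiagonal n,
      x ^ p.1 * y ^ p.2 / (p.1.factorial * p.2.factorial) = (x + y) ^ n / n.factorial := by
  rw [(Commute.all x y).add_pow', Finset.sum_div]
  refine Finset.sum_congr rfl fun p hp => ?_
  obtain rfl := Finset.HasAntidiagonal.mem_antidiagonal.1 hp
  have choose_ne_zero : ((p.1 + p.2).choose p.1 : ℝ) ≠ 0 := by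
    exact_mod_cast (Nat.choose_pos (Nat.le_add_right _ _)).ne'
  rw [nsmul_eq_mul, ← Nat.add_choose_mul_factorial_mul_factorial, ← Nat.choose_symm_add]
  push_cast
  field_simp

theorem tsum_besselClifford_add {a : ℝ} (ha : 0 < a) (x y : ℝ) :
    ∑' p : ℕ × ℕ, x ^ p.1 * y ^ p.2 /
      (p.1.factorial * p.2.factorial * Real.Gamma (a + (p.1 + p.2 : ℕ))) =
    besselClifford a (x + y) := by
  let e := Finset.HasAntidiagonal.sigmaAntidiagonalEquivProd (A := ℕ)
  have summable_sigma := e.summable_iff.2 (summable_norm_besselClifford_add ha x y).of_norm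
  rw [← e.tsum_eq]
  refine (summable_sigma.tsum_sigma' fun n => (hasSum_fintype _).summable).trans ?_
  refine tsum_congr fun n => ?_
  rw [tsum_fintype, ← div_div, ← sum_antidiagonal_pow_div_factorial, Finset.sum_div,
    ← Finset.sum_coe_sort (Finset.HasAntidiagonal.antidiagonal n)]
  refine Finset.sum_congr rfl fun ⟨p, hp⟩ _ => ?_
  obtain rfl := Finset.HasAntidiagonal.mem_antidiagonal.1 hp
  exact (div_div _ _ _).symm

/-! ### The Poisson–Sonine integral -/

theorem setIntegral_rpow_mul_one_sub_rpow {α β : ℝ} (hα : 0 < α) (hβ : 0 < β) :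
    ∫ x in Set.Ioo (0 : ℝ) 1, x ^ (α - 1) * (1 - x) ^ (β - 1) =
      Real.Gamma α * Real.Gamma β / Real.Gamma (α + β) := by
  have beta_eq := Complex.betaIntegral_eq_Gamma_mul_div α β (by simpa) (by simpa)
  rw [Complex.betaIntegral, intervalIntegral.integral_of_le zero_le_one,
    integral_Ioc_eq_integral_Ioo] at beta_eq
  have integrand_eq : ∀ x ∈ Set.Ioo (0 : ℝ) 1, (x : ℂ) ^ ((α : ℂ) - 1) *
      (1 - (x : ℂ)) ^ ((β : ℂ) - 1) = ((x ^ (α - 1) * (1 - x) ^ (β - 1) : ℝ) : ℂ) := fun x hx => by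
    push_cast [Complex.ofReal_cpow hx.1.le, Complex.ofReal_cpow (sub_pos.2 hx.2).le]
    rfl
  rw [setIntegral_congr_fun measurableSet_Ioo integrand_eq, integral_complex_ofReal,
    ← Complex.ofReal_add, Complex.Gamma_ofReal, Complex.Gamma_ofReal, Complex.Gamma_ofReal]
    at beta_eq
  exact_mod_cast beta_eq

theorem image_sq_Ioo_zero_one : (fun t : ℝ => t ^ 2) '' Set.Ioo 0 1 = Set.Ioo 0 1 := by
  ext y
  constructor
  · rintro ⟨t, ⟨t_pos, t_lt⟩, rfl⟩
    exact ⟨by positivity, by nlinarith⟩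
  · rintro ⟨y_pos, y_lt⟩
    exact ⟨√y, ⟨Real.sqrt_pos.2 y_pos, by simpa [Real.sqrt_lt' one_pos]⟩, Real.sq_sqrt y_pos.le⟩

theorem setIntegral_Ioo_comp_sq (g : ℝ → ℝ) :
    ∫ t in Set.Ioo (0 : ℝ) 1, t * g (t ^ 2) = (∫ y in Set.Ioo (0 : ℝ) 1, g y) / 2 := by
  have sq_injOn : Set.InjOn (fun t : ℝ => t ^ 2) (Set.Ioo 0 1) :=
    fun s hs t ht => (sq_eq_sq₀ hs.1.le ht.1.le).1
  have substitution := integral_image_eq_integral_abs_deriv_smul measurableSet_Ioo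
    (fun t _ => (hasDerivAt_pow 2 t).hasDerivWithinAt) sq_injOn g
  rw [image_sq_Ioo_zero_one] at substitution
  rw [substitution, ← integral_div]
  refine setIntegral_congr_fun measurableSet_Ioo fun t ht => ?_
  have ht_pos := ht.1
  simp only [Nat.cast_ofNat, Nat.add_one_sub_one, pow_one, smul_eq_mul]
  rw [abs_of_pos (by positivity)]
  ring

theorem setIntegral_pow_mul_one_sub_sq_rpow {b : ℝ} (hb : 0 < b) (n : ℕ) :
    ∫ t in Set.Ioo (0 : ℝ) 1, t ^ (2 * n) * (1 - t ^ 2) ^ (b - 1) =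
      Real.Gamma (n + 1 / 2) * Real.Gamma b / Real.Gamma (n + 1 / 2 + b) / 2 := by
  rw [← setIntegral_rpow_mul_one_sub_rpow (by positivity) hb, ← setIntegral_Ioo_comp_sq]
  refine setIntegral_congr_fun measurableSet_Ioo fun t ht => ?_
  have pow_eq : t ^ (2 * n) = t * (t ^ 2) ^ ((n : ℝ) + 1 / 2 - 1) := by
    rw [← Real.rpow_natCast t 2, ← Real.rpow_mul ht.1.le, mul_comm t, ← Real.rpow_add_one ht.1.ne',
      ← Real.rpow_natCast t (2 * n)]
    congr 1
    push_cast
    ring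
  simp only [pow_eq, mul_assoc]

theorem integrableOn_pow_mul_one_sub_sq_rpow {b : ℝ} (hb : 0 < b) (n : ℕ) :
    IntegrableOn (fun t : ℝ => t ^ (2 * n) * (1 - t ^ 2) ^ (b - 1)) (Set.Ioo 0 1) := by
  refine .of_integral_ne_zero ?_
  rw [setIntegral_pow_mul_one_sub_sq_rpow hb]
  have (x : ℝ) (hx : 0 < x) := Real.Gamma_pos_of_pos hx
  have := this (n + 1 / 2) (by positivity)
  have := Real.Gamma_pos_of_pos (show 0 < n + 1 / 2 + b by positivity)
  have := Real.Gamma_pos_of_pos hb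
  positivity

theorem factorial_two_mul_mul_sqrt_pi (n : ℕ) :
    ((2 * n).factorial : ℝ) * √Real.pi = 4 ^ n * n.factorial * Real.Gamma (n + 1 / 2) := by
  have duplication := Real.Gamma_mul_Gamma_add_half (n + 1 / 2)
  rw [show (n : ℝ) + 1 / 2 + 1 / 2 = n + 1 by ring, show 2 * ((n : ℝ) + 1 / 2) = (2 * n : ℕ) + 1 by
    push_cast; ring, Real.Gamma_nat_eq_factorial, Real.Gamma_nat_eq_factorial,
    show (1 : ℝ) - ((2 * n : ℕ) + 1) = -(2 * n : ℕ) by ring, Real.rpow_neg zero_le_two,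
    Real.rpow_natCast, pow_mul] at duplication
  rw [mul_assoc, mul_comm (n.factorial : ℝ), duplication]
  field_simp
  norm_num

/-- The function of `t ∈ (0, 1)` whose cosine transform is, by `besselClifford_eq_integral_cos`, a
Bessel–Clifford function of order `b + 1 / 2` with shifted argument. -/
def besselDensity (b x t : ℝ) : ℝ :=
  2 / √Real.pi * (1 - t ^ 2) ^ (b - 1) * besselClifford b (x * (1 - t ^ 2))

theorem integrableOn_besselDensity {b : ℝ} (hb : 0 < b) (x : ℝ) :
    IntegrableOn (besselDensity b x) (Set.Ioo 0 1) := by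
  have integrableOn_weight := integrableOn_pow_mul_one_sub_sq_rpow hb 0
  simp only [mul_zero, pow_zero, one_mul] at integrableOn_weight
  have continuous_comp : Continuous fun t : ℝ => besselClifford b (x * (1 - t ^ 2)) :=
    (continuous_besselClifford hb).comp (by fun_prop)
  obtain ⟨C, hC⟩ := (isCompact_Icc (a := (0 : ℝ)) (b := 1)).exists_bound_of_continuousOn
    continuous_comp.continuousOn
  refine (Integrable.const_mul integrableOn_weight _).mul_bdd (c := C)
    continuous_comp.aestronglyMeasurable.restrict ?_
  exact ae_restrict_of_forall_mem measurableSet_Ioo fun t ht => hC t (Set.Ioo_subset_Icc_self ht)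

/-- The terms of the double series that results from expanding both factors of
`besselDensity b x t * cos (θ * t)`, with `y = -θ²`. -/
def poissonTerm (b x y : ℝ) (p : ℕ × ℕ) (t : ℝ) : ℝ :=
  2 / √Real.pi * (x ^ p.1 * y ^ p.2 /
    (p.1.factorial * Real.Gamma (b + p.1) * (2 * p.2).factorial)) *
      (t ^ (2 * p.2) * (1 - t ^ 2) ^ (b + p.1 - 1))

theorem integrableOn_poissonTerm {b : ℝ} (hb : 0 < b) (x y : ℝ) (p : ℕ × ℕ) :
    IntegrableOn (poissonTerm b x y p) (Set.Ioo 0 1) :=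
  Integrable.const_mul (integrableOn_pow_mul_one_sub_sq_rpow (by positivity) p.2) _

theorem setIntegral_poissonTerm {b : ℝ} (hb : 0 < b) (x y : ℝ) (p : ℕ × ℕ) :
    ∫ t in Set.Ioo (0 : ℝ) 1, poissonTerm b x y p t = x ^ p.1 * (y / 4) ^ p.2 /
      (p.1.factorial * p.2.factorial * Real.Gamma (b + 1 / 2 + (p.1 + p.2 : ℕ))) := by
  have := Real.Gamma_pos_of_pos (show 0 < b + p.1 by positivity)
  have := Real.Gamma_pos_of_pos (show (0 : ℝ) < p.2 + 1 / 2 by positivity)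
  have factorial_eq : ((2 * p.2).factorial : ℝ) =
      4 ^ p.2 * p.2.factorial * Real.Gamma (p.2 + 1 / 2) / √Real.pi := by
    rw [← factorial_two_mul_mul_sqrt_pi]
    field_simp
  simp only [poissonTerm]
  rw [integral_const_mul, setIntegral_pow_mul_one_sub_sq_rpow (by positivity), factorial_eq,
    show (b + 1 / 2 + (p.1 + p.2 : ℕ) : ℝ) = p.2 + 1 / 2 + (b + p.1) by push_cast; ring, div_pow]
  field_simp

theorem norm_poissonTerm {b : ℝ} (hb : 0 < b) (x y : ℝ) (p : ℕ × ℕ) {t : ℝ}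
    (ht : t ∈ Set.Ioo (0 : ℝ) 1) : ‖poissonTerm b x y p t‖ = poissonTerm b |x| |y| p t := by
  have := Real.Gamma_pos_of_pos (show 0 < b + p.1 by positivity)
  have one_sub_nonneg : 0 ≤ 1 - t ^ 2 := by nlinarith [ht.1, ht.2]
  have t_nonneg := ht.1.le
  simp only [poissonTerm, norm_mul, norm_div, norm_pow, Real.norm_eq_abs x, Real.norm_eq_abs y]
  rw [Real.norm_of_nonneg (Real.rpow_nonneg one_sub_nonneg _), Real.norm_of_nonneg this.le]
  simp [abs_of_nonneg t_nonneg, abs_of_nonneg (Real.sqrt_nonneg Real.pi)]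

theorem summable_integral_norm_poissonTerm {b : ℝ} (hb : 0 < b) (x y : ℝ) :
    Summable fun p => ∫ t in Set.Ioo (0 : ℝ) 1, ‖poissonTerm b x y p t‖ := by
  have summable_series :=
    (summable_norm_besselClifford_add (a := b + 1 / 2) (by positivity) |x| (|y| / 4)).of_norm
  refine summable_series.congr fun p => ?_
  rw [← setIntegral_poissonTerm hb]
  exact setIntegral_congr_fun measurableSet_Ioo fun t ht => (norm_poissonTerm hb x y p ht).symm

theorem tsum_poissonTerm {b : ℝ} (hb : 0 < b) (x θ : ℝ) {t : ℝ} (ht : t ∈ Set.Ioo (0 : ℝ) 1) :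
    ∑' p, poissonTerm b x (-θ ^ 2) p t = besselDensity b x t * Real.cos (θ * t) := by
  have one_sub_pos : 0 < 1 - t ^ 2 := by nlinarith [ht.1, ht.2]
  have cos_series := Real.hasSum_cos (θ * t)
  rw [besselDensity, besselClifford, ← cos_series.tsum_eq, mul_assoc,
    tsum_mul_tsum_of_summable_norm (summable_norm_besselClifford hb _) cos_series.summable.norm,
    ← tsum_mul_left]
  refine tsum_congr fun p => ?_
  have rpow_eq : (1 - t ^ 2) ^ (b + p.1 - 1) = (1 - t ^ 2) ^ (b - 1) * (1 - t ^ 2) ^ p.1 := by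
    rw [← Real.rpow_add_natCast one_sub_pos.ne']
    congr 1
    ring
  rw [poissonTerm, rpow_eq, mul_pow, mul_pow, neg_pow, ← pow_mul]
  ring

/-- Poisson's integral for `J_μ`, in Sonine's form with the shift `x` of the argument. -/
theorem besselClifford_eq_integral_cos {b : ℝ} (hb : 0 < b) (x θ : ℝ) :
    besselClifford (b + 1 / 2) (x - θ ^ 2 / 4) =
      ∫ t in Set.Ioo (0 : ℝ) 1, besselDensity b x t * Real.cos (θ * t) :=
  calc _ = besselClifford (b + 1 / 2) (x + -θ ^ 2 / 4) := by ring_nf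
    _ = ∑' p, ∫ t in Set.Ioo (0 : ℝ) 1, poissonTerm b x (-θ ^ 2) p t := by
        rw [← tsum_besselClifford_add (by positivity)]
        exact tsum_congr fun p => (setIntegral_poissonTerm hb _ _ p).symm
    _ = ∫ t in Set.Ioo (0 : ℝ) 1, ∑' p, poissonTerm b x (-θ ^ 2) p t :=
        integral_tsum_of_summable_integral_norm (integrableOn_poissonTerm hb _ _)
          (summable_integral_norm_poissonTerm hb _ _)
    _ = _ := setIntegral_congr_fun measurableSet_Ioo fun _ ht => tsum_poissonTerm hb x θ ht

/-! ### Fourier transforms of compactly supported functions -/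

/-- The Fourier transform with kernel `exp(iωt)`: the normalization of the plane waves, in place of
the kernel `exp(-2πiωt)` of `FourierTransform.fourier`. -/
def angularFourier (φ : ℝ → ℂ) (ω : ℝ) : ℂ := ∫ t : ℝ, Complex.exp (Complex.I * ω * t) * φ t

theorem norm_exp_I_mul_mul (ω t : ℝ) : ‖Complex.exp (Complex.I * ω * t)‖ = 1 := by
  rw [mul_assoc, ← Complex.ofReal_mul, Complex.norm_exp_I_mul_ofReal]

theorem integrable_exp_I_mul_mul {φ : ℝ → ℂ} (hφ : Integrable φ) (ω : ℝ) :
    Integrable fun t : ℝ => Complex.exp (Complex.I * ω * t) * φ t :=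
  hφ.bdd_mul (by fun_prop) (ae_of_all _ fun t => (norm_exp_I_mul_mul ω t).le)

theorem angularFourier_eq_fourier (φ : ℝ → ℂ) (ω : ℝ) :
    angularFourier φ ω = 𝓕 φ (-(2 * Real.pi)⁻¹ * ω) := by
  have := Real.pi_ne_zero
  rw [angularFourier, Real.fourier_real_eq_integral_exp_smul]
  congr! 3 with t
  push_cast
  field_simp

theorem fourier_eq_angularFourier (φ : ℝ → ℂ) (ω : ℝ) :
    𝓕 φ ω = angularFourier φ (-(2 * Real.pi) * ω) := by
  have := Real.pi_ne_zero
  rw [angularFourier_eq_fourier]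
  field_simp

theorem angularFourier_congr_ae {φ ψ : ℝ → ℂ} (h : φ =ᵐ[volume] ψ) :
    angularFourier φ = angularFourier ψ :=
  funext fun ω => integral_congr_ae (h.mono fun t ht => by simp only [ht])

theorem angularFourier_add {φ ψ : ℝ → ℂ} (hφ : Integrable φ) (hψ : Integrable ψ) (ω : ℝ) :
    angularFourier (fun t => φ t + ψ t) ω = angularFourier φ ω + angularFourier ψ ω := by
  simp only [angularFourier, mul_add]
  exact integral_add (integrable_exp_I_mul_mul hφ ω) (integrable_exp_I_mul_mul hψ ω)

theorem angularFourier_const_mul (c : ℂ) (φ : ℝ → ℂ) (ω : ℝ) :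
    angularFourier (fun t => c * φ t) ω = c * angularFourier φ ω := by
  simp only [angularFourier, mul_left_comm _ c]
  exact integral_const_mul _ _

theorem norm_angularFourier_le (φ : ℝ → ℂ) (ω : ℝ) : ‖angularFourier φ ω‖ ≤ ∫ t, ‖φ t‖ := by
  refine (norm_integral_le_integral_norm _).trans_eq ?_
  simp only [norm_mul, norm_exp_I_mul_mul, one_mul]

theorem continuous_angularFourier {φ : ℝ → ℂ} (hφ : Integrable φ) :
    Continuous (angularFourier φ) :=
  continuous_of_dominated (fun ω => (integrable_exp_I_mul_mul hφ ω).aestronglyMeasurable)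
    (fun ω => ae_of_all _ fun t => by rw [norm_mul, norm_exp_I_mul_mul, one_mul]) hφ.norm
    (ae_of_all _ fun t => by fun_prop)

theorem tendsto_angularFourier_cocompact (φ : ℝ → ℂ) :
    Tendsto (angularFourier φ) (cocompact ℝ) (𝓝 0) := by
  rw [funext (angularFourier_eq_fourier φ)]
  exact (Real.zero_at_infty_fourier φ).comp
    (tendsto_cocompact_mul_left₀ (by simp [Real.pi_ne_zero]))

theorem angularFourier_comp_add_right (φ : ℝ → ℂ) (τ ω : ℝ) :
    angularFourier (fun t => φ (t + τ)) ω =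
      Complex.exp (-Complex.I * ω * τ) * angularFourier φ ω := by
  rw [angularFourier, angularFourier, ← integral_const_mul,
    ← integral_add_right_eq_self (fun t => Complex.exp (-Complex.I * ω * τ) * _) τ]
  congr! 2
  rw [← mul_assoc, ← Complex.exp_add]
  push_cast
  ring_nf

theorem angularFourier_comp_mul_left (φ : ℝ → ℂ) {c : ℝ} (hc : c ≠ 0) (ω : ℝ) :
    angularFourier (fun t => φ (c * t)) ω = (|c⁻¹| : ℝ) * angularFourier φ (c⁻¹ * ω) := by
  have := Complex.ofReal_ne_zero.2 hc
  rw [angularFourier, angularFourier, ← Complex.real_smul, ← Measure.integral_comp_mul_left]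
  congr! 3 with t
  push_cast
  field_simp

theorem hasDerivAt_angularFourier {φ : ℝ → ℂ} (hφ : Integrable φ)
    (hφ' : Integrable fun t : ℝ => t * φ t) (ω : ℝ) :
    HasDerivAt (angularFourier φ) (Complex.I * angularFourier (fun t => t * φ t) ω) ω := by
  have := Complex.ofReal_ne_zero.2 Real.pi_ne_zero
  have fourier_comp := (Real.hasDerivAt_fourier hφ hφ' (-(2 * Real.pi)⁻¹ * ω)).scomp ω
    (hasDerivAt_const_mul (-(2 * Real.pi)⁻¹))
  rw [← angularFourier_eq_fourier] at fourier_comp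
  rw [funext (angularFourier_eq_fourier φ)]
  refine fourier_comp.congr_deriv ?_
  simp only [smul_eq_mul, mul_assoc (_ * Complex.I)]
  rw [angularFourier_const_mul, Complex.real_smul]
  push_cast
  field_simp

theorem angularFourier_mul_eq_zero {φ : ℝ → ℂ} (hφ : Integrable φ)
    (hφ' : Integrable fun t : ℝ => t * φ t) {U : Set ℝ} (hU : IsOpen U)
    (h0 : ∀ ω ∈ U, angularFourier φ ω = 0) {ω : ℝ} (hω : ω ∈ U) :
    angularFourier (fun t => t * φ t) ω = 0 := by
  have eventuallyEq_zero : angularFourier φ =ᶠ[𝓝 ω] fun _ => 0 :=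
    (hU.eventually_mem hω).mono h0
  have deriv_eq_zero := (hasDerivAt_angularFourier hφ hφ' ω).unique
    (eventuallyEq_zero.symm.hasDerivAt_iff.1 (hasDerivAt_const ω 0))
  exact (mul_eq_zero.1 deriv_eq_zero).resolve_left Complex.I_ne_zero

/-- Dini's criterion for Fourier inversion at a point. -/
theorem tendsto_intervalIntegral_angularFourier {φ : ℝ → ℂ} (hφ : Integrable φ)
    (hφ' : Integrable fun t : ℝ => φ t / t) :
    Tendsto (fun R : ℝ => ∫ ω in (-R)..R, angularFourier φ ω) atTop (𝓝 0) := by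
  have mul_div_cancel_ae : (fun t : ℝ => t * (φ t / t)) =ᵐ[volume] φ := by
    filter_upwards [Measure.ae_ne volume 0] with t ht
    exact mul_div_cancel₀ _ (Complex.ofReal_ne_zero.2 ht)
  set Φ : ℝ → ℂ := fun ω => -Complex.I * angularFourier (fun t => φ t / t) ω
  have hasDerivAt_primitive (ω : ℝ) : HasDerivAt Φ (angularFourier φ ω) ω := by
    have := (hasDerivAt_angularFourier hφ' (hφ.congr mul_div_cancel_ae.symm) ω).const_mul
      (-Complex.I)
    rwa [angularFourier_congr_ae mul_div_cancel_ae, ← mul_assoc, neg_mul, Complex.I_mul_I,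
      neg_neg, one_mul] at this
  have tendsto_primitive : Tendsto Φ (cocompact ℝ) (𝓝 0) := by
    simpa only [mul_zero] using
      (tendsto_angularFourier_cocompact fun t => φ t / t).const_mul (-Complex.I)
  have primitive_sub (R : ℝ) : ∫ ω in (-R)..R, angularFourier φ ω = Φ R - Φ (-R) :=
    intervalIntegral.integral_eq_sub_of_hasDerivAt (fun ω _ => hasDerivAt_primitive ω)
      ((continuous_angularFourier hφ).intervalIntegrable _ _)
  simp only [primitive_sub]
  simpa using (tendsto_primitive.mono_left atTop_le_cocompact).sub
    ((tendsto_primitive.mono_left atBot_le_cocompact).comp tendsto_neg_atTop_atBot)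

theorem integral_angularFourier_mul {φ F : ℝ → ℂ} (hφ : Integrable φ) (hF : Integrable F) :
    ∫ ω, angularFourier φ ω * F ω = ∫ t, φ t * angularFourier F t := by
  have integrable_prod : Integrable (fun q : ℝ × ℝ =>
      Complex.exp (Complex.I * q.1 * q.2) * (F q.1 * φ q.2)) (volume.prod volume) :=
    (hF.mul_prod hφ).bdd_mul (by fun_prop) (ae_of_all _ fun q => (norm_exp_I_mul_mul q.1 q.2).le)
  calc ∫ ω, angularFourier φ ω * F ω
      = ∫ ω : ℝ, ∫ t : ℝ, Complex.exp (Complex.I * ω * t) * (F ω * φ t) := by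
        simp only [angularFourier, ← integral_mul_const, mul_comm (F _), mul_assoc]
    _ = ∫ t : ℝ, ∫ ω : ℝ, Complex.exp (Complex.I * ω * t) * (F ω * φ t) :=
        integral_integral_swap integrable_prod
    _ = ∫ t, φ t * angularFourier F t := by
        congr! 2 with t
        rw [angularFourier, ← integral_const_mul]
        congr! 2
        ring_nf

theorem angularFourier_angularFourier {φ : ℝ → ℂ} (hφc : Continuous φ) (hφ : Integrable φ)
    (hφ' : Integrable (angularFourier φ)) (y : ℝ) :
    angularFourier (angularFourier φ) y = 2 * Real.pi * φ (-y) := by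
  have := Real.pi_ne_zero
  have integrable_fourier : Integrable (𝓕 φ) := by
    rw [funext (fourier_eq_angularFourier φ)]
    exact hφ'.comp_mul_left' (by simp)
  calc angularFourier (angularFourier φ) y
      = angularFourier (fun ω => 𝓕 φ (-(2 * Real.pi)⁻¹ * ω)) y := by
        rw [← funext (angularFourier_eq_fourier φ)]
    _ = 2 * Real.pi * 𝓕 (𝓕 φ) y := by
        rw [angularFourier_comp_mul_left _ (by simp), inv_neg, inv_inv, abs_neg,
          abs_of_pos Real.two_pi_pos, fourier_eq_angularFourier (𝓕 φ)]
        push_cast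
        rfl
    _ = 2 * Real.pi * φ (-y) := by
        rw [← hφc.fourierInv_fourier_eq hφ integrable_fourier, Real.fourierInv_eq_fourier_neg,
          neg_neg, hφc.fourierInv_fourier_eq hφ integrable_fourier]

/-- `s` is the Fourier transform of an integrable function that vanishes off `(-r, r)`. -/
def IsPaleyWiener (r : ℝ) (s : ℝ → ℂ) : Prop :=
  ∃ φ : ℝ → ℂ, Integrable φ ∧ (∀ t, r ≤ |t| → φ t = 0) ∧ s = angularFourier φ

namespace IsPaleyWiener

variable {r : ℝ} {s s' : ℝ → ℂ}

theorem add (hs : IsPaleyWiener r s) (hs' : IsPaleyWiener r s') :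
    IsPaleyWiener r (fun ω => s ω + s' ω) := by
  obtain ⟨φ, hφ, φ_eq_zero, rfl⟩ := hs
  obtain ⟨ψ, hψ, ψ_eq_zero, rfl⟩ := hs'
  exact ⟨fun t => φ t + ψ t, hφ.add hψ, fun t ht => by simp [φ_eq_zero t ht, ψ_eq_zero t ht],
    funext fun ω => (angularFourier_add hφ hψ ω).symm⟩

theorem const_mul (hs : IsPaleyWiener r s) (c : ℂ) : IsPaleyWiener r (fun ω => c * s ω) := by
  obtain ⟨φ, hφ, φ_eq_zero, rfl⟩ := hs
  exact ⟨fun t => c * φ t, hφ.const_mul c, fun t ht => by simp [φ_eq_zero t ht],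
    funext fun ω => (angularFourier_const_mul c φ ω).symm⟩

theorem comp_mul_left (hs : IsPaleyWiener r s) {c : ℝ} (hc : c ≠ 0) :
    IsPaleyWiener (|c| * r) (fun ω => s (c * ω)) := by
  obtain ⟨φ, hφ, φ_eq_zero, rfl⟩ := hs
  refine ⟨fun t => (|c⁻¹| : ℝ) * φ (c⁻¹ * t), (hφ.comp_mul_left' (inv_ne_zero hc)).const_mul _,
    fun t ht => ?_, funext fun ω => ?_⟩
  · have : r ≤ |c⁻¹ * t| := by
      rwa [abs_mul, abs_inv, inv_mul_eq_div, le_div_iff₀' (abs_pos.2 hc)]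
    simp [φ_eq_zero _ this]
  · rw [angularFourier_const_mul, angularFourier_comp_mul_left _ (inv_ne_zero hc), inv_inv,
      ← mul_assoc, ← Complex.ofReal_mul, ← abs_mul, inv_mul_cancel₀ hc]
    simp

theorem setIntegral_mul_cos {ψ : ℝ → ℝ} (hψ : IntegrableOn ψ (Set.Ioo 0 1)) :
    IsPaleyWiener 1 fun ω => ((∫ t in Set.Ioo (0 : ℝ) 1, ψ t * Real.cos (ω * t) : ℝ) : ℂ) := by
  set Ψ : ℝ → ℂ := (Set.Ioo 0 1).indicator fun t => (ψ t : ℂ) with Ψ_def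
  have hΨ : Integrable Ψ := IntegrableOn.integrable_indicator hψ.ofReal measurableSet_Ioo
  have hs : IsPaleyWiener 1 (angularFourier Ψ) :=
    ⟨Ψ, hΨ, fun t ht => Set.indicator_of_notMem (fun h => by
      rw [abs_of_pos h.1] at ht; exact ht.not_gt h.2) _, rfl⟩
  have hs_neg : IsPaleyWiener 1 fun ω => angularFourier Ψ (-1 * ω) := by
    simpa using hs.comp_mul_left (neg_ne_zero.2 one_ne_zero)
  convert (hs.add hs_neg).const_mul (1 / 2) using 2 with ω
  rw [angularFourier, angularFourier, ← integral_add (integrable_exp_I_mul_mul hΨ _)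
    (integrable_exp_I_mul_mul hΨ _), ← integral_const_mul, ← integral_complex_ofReal,
    ← integral_indicator measurableSet_Ioo]
  refine integral_congr_ae (ae_of_all _ fun t => ?_)
  by_cases ht : t ∈ Set.Ioo (0 : ℝ) 1
  · simp only [Ψ_def, Set.indicator_of_mem ht]
    push_cast
    rw [Complex.cos]
    ring_nf
  · simp [Ψ_def, Set.indicator_of_notMem ht]

theorem bounded (hs : IsPaleyWiener r s) : ∃ C, ∀ ω, ‖s ω‖ ≤ C := by
  obtain ⟨φ, -, -, rfl⟩ := hs
  exact ⟨_, norm_angularFourier_le φ⟩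

theorem continuous (hs : IsPaleyWiener r s) : Continuous s := by
  obtain ⟨φ, hφ, -, rfl⟩ := hs
  exact continuous_angularFourier hφ

theorem integrable_mul (hs : IsPaleyWiener r s) {F : ℝ → ℂ} (hF : Integrable F) :
    Integrable fun ω => s ω * F ω := by
  obtain ⟨C, hC⟩ := hs.bounded
  exact hF.bdd_mul hs.continuous.aestronglyMeasurable (ae_of_all _ hC)

theorem integral_mul_eq_zero (hs : IsPaleyWiener r s) {F : ℝ → ℂ} (hF : Integrable F)
    (h0 : ∀ y ∈ Set.Ioo (-r) r, angularFourier F y = 0) : ∫ ω, s ω * F ω = 0 := by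
  obtain ⟨φ, hφ, φ_eq_zero, rfl⟩ := hs
  rw [integral_angularFourier_mul hφ hF]
  refine integral_eq_zero_of_ae (ae_of_all _ fun t => ?_)
  rcases lt_or_ge |t| r with ht | ht
  · simp [h0 t (abs_lt.1 ht)]
  · simp [φ_eq_zero t ht]

theorem tendsto_intervalIntegral_exp_mul (hs : IsPaleyWiener r s) {τ : ℝ} (hτ : r < |τ|) :
    Tendsto (fun R : ℝ => ∫ ω in (-R)..R, Complex.exp (-Complex.I * ω * τ) * s ω) atTop (𝓝 0) := by
  obtain ⟨φ, hφ, φ_eq_zero, rfl⟩ := hs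
  simp only [← angularFourier_comp_add_right]
  have translate_integrable := hφ.comp_add_right τ
  refine tendsto_intervalIntegral_angularFourier translate_integrable <|
    (translate_integrable.norm.const_mul (|τ| - r)⁻¹).mono'
      (translate_integrable.aestronglyMeasurable.aemeasurable.div
        (by fun_prop)).aestronglyMeasurable (ae_of_all _ fun t => ?_)
  rcases lt_or_ge |t + τ| r with ht | ht
  · have : 0 < |τ| - r := sub_pos.2 hτ
    have gap_le : |τ| - r ≤ |t| := by
      have := abs_sub_abs_le_abs_sub τ (t + τ)
      rw [sub_add_cancel_right, abs_neg] at this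
      linarith
    rw [norm_div, div_eq_inv_mul, Complex.norm_real, Real.norm_eq_abs]
    gcongr
  · simp [φ_eq_zero _ ht]

end IsPaleyWiener

theorem besselClifford_bounded_of_nonpos {a : ℝ} (ha : 1 / 2 < a) :
    ∃ C, ∀ x ≤ 0, |besselClifford a x| ≤ C := by
  have hb : 0 < a - 1 / 2 := by linarith
  obtain ⟨C, hC⟩ :=
    (IsPaleyWiener.setIntegral_mul_cos (integrableOn_besselDensity hb 0)).bounded
  refine ⟨C, fun x hx => ?_⟩
  have bound := hC (2 * √(-x))
  rwa [← besselClifford_eq_integral_cos hb, Complex.norm_real, Real.norm_eq_abs,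
    mul_pow, Real.sq_sqrt (by linarith), sub_add_cancel,
    show 0 - 2 ^ 2 * -x / 4 = x by ring] at bound

theorem besselClifford_linear_growth_of_nonpos {a : ℝ} (ha : 0 < a) :
    ∃ C, ∀ x ≤ 0, |besselClifford a x| ≤ C * (1 + |x|) := by
  obtain ⟨C₁, hC₁⟩ := besselClifford_bounded_of_nonpos (a := a + 1) (by linarith)
  obtain ⟨C₂, hC₂⟩ := besselClifford_bounded_of_nonpos (a := a + 2) (by linarith)
  have C₁_nonneg : 0 ≤ C₁ := (abs_nonneg _).trans (hC₁ 0 le_rfl)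
  have C₂_nonneg : 0 ≤ C₂ := (abs_nonneg _).trans (hC₂ 0 le_rfl)
  refine ⟨a * C₁ + C₂, fun x hx => ?_⟩
  calc |besselClifford a x|
      = |a * besselClifford (a + 1) x + x * besselClifford (a + 2) x| := by
        rw [besselClifford_recurrence ha]
    _ ≤ a * |besselClifford (a + 1) x| + |x| * |besselClifford (a + 2) x| := by
        rw [← abs_mul, ← abs_of_pos ha, ← abs_mul, abs_of_pos ha]
        exact abs_add_le _ _
    _ ≤ a * C₁ + |x| * C₂ := by gcongr <;> simp only [hC₁, hC₂, hx]
    _ ≤ (a * C₁ + C₂) * (1 + |x|) := by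
        have : 0 ≤ a * C₁ * |x| + C₂ := by positivity
        linarith

theorem besselClifford_linear_growth {a : ℝ} (ha : 0 < a) (B : ℝ) :
    ∃ C, ∀ x ≤ B, |besselClifford a x| ≤ C * (1 + |x|) := by
  obtain ⟨C₁, hC₁⟩ := besselClifford_linear_growth_of_nonpos ha
  obtain ⟨C₂, hC₂⟩ := (isCompact_Icc (a := 0) (b := B)).exists_bound_of_continuousOn
    (continuous_besselClifford ha).continuousOn
  refine ⟨max C₁ |C₂|, fun x hx => ?_⟩
  rcases le_total x 0 with x_nonpos | x_nonneg
  · exact (hC₁ x x_nonpos).trans (by gcongr; exact le_max_left _ _)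
  · calc |besselClifford a x| ≤ |C₂| := (hC₂ x ⟨x_nonneg, hx⟩).trans (le_abs_self C₂)
      _ ≤ |C₂| * (1 + |x|) := le_mul_of_one_le_right (abs_nonneg _) (by simp)
      _ ≤ max C₁ |C₂| * (1 + |x|) := by gcongr; exact le_max_right _ _

/-! ### Mode symbols -/

/-- The entire function of `ω² - k²` that `modeSymbol (a - 1)` agrees with off the light cone
`ω² = k²`. -/
def smoothSymbol (a Z ω k : ℝ) : ℝ :=
  Real.Gamma a * Z ^ a * besselClifford a (Z ^ 2 * (k ^ 2 - ω ^ 2) / 4)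

theorem continuous_smoothSymbol {a : ℝ} (ha : 0 < a) (Z : ℝ) :
    Continuous fun q : ℝ × ℝ => smoothSymbol a Z q.1 q.2 :=
  continuous_const.mul ((continuous_besselClifford ha).comp (by fun_prop))

theorem smoothSymbol_growth {a : ℝ} (ha : 0 < a) (Z B : ℝ) :
    ∃ C, ∀ ω k : ℝ, k ^ 2 - ω ^ 2 ≤ B →
      |smoothSymbol a Z ω k| ≤ C * ((1 + ω ^ 2) * (1 + k ^ 2)) := by
  obtain ⟨C, hC⟩ := besselClifford_linear_growth ha (Z ^ 2 * B / 4)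
  have C_nonneg : 0 ≤ C := by
    have bound := (abs_nonneg _).trans (hC _ (min_le_left (Z ^ 2 * B / 4) 0))
    exact nonneg_of_mul_nonneg_left bound (by positivity)
  refine ⟨|Real.Gamma a * Z ^ a| * (C * (1 + Z ^ 2 / 4)), fun ω k hωk => ?_⟩
  have abs_argument_le : |Z ^ 2 * (k ^ 2 - ω ^ 2) / 4| ≤ Z ^ 2 / 4 * (k ^ 2 + ω ^ 2) := by
    rw [mul_div_right_comm, abs_mul, abs_of_nonneg (by positivity : 0 ≤ Z ^ 2 / 4)]
    gcongr
    rw [abs_le]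
    constructor <;> linarith [sq_nonneg k, sq_nonneg ω]
  calc |smoothSymbol a Z ω k|
      ≤ |Real.Gamma a * Z ^ a| * (C * (1 + |Z ^ 2 * (k ^ 2 - ω ^ 2) / 4|)) := by
        rw [smoothSymbol, abs_mul]
        gcongr
        exact hC _ (by gcongr)
    _ ≤ |Real.Gamma a * Z ^ a| * (C * ((1 + Z ^ 2 / 4) * ((1 + ω ^ 2) * (1 + k ^ 2)))) := by
        gcongr
        have : 0 ≤ ω ^ 2 + k ^ 2 + (1 + Z ^ 2 / 4) * (ω ^ 2 * k ^ 2) + Z ^ 2 / 4 := by positivity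
        linarith
    _ = |Real.Gamma a * Z ^ a| * (C * (1 + Z ^ 2 / 4)) * ((1 + ω ^ 2) * (1 + k ^ 2)) := by ring

theorem isPaleyWiener_besselClifford {a Z : ℝ} (ha : 1 / 2 < a) (hZ : 0 < Z) (k : ℝ) :
    IsPaleyWiener Z fun ω => (besselClifford a (Z ^ 2 * (k ^ 2 - ω ^ 2) / 4) : ℂ) := by
  have hb : 0 < a - 1 / 2 := by linarith
  convert (IsPaleyWiener.setIntegral_mul_cos
    (integrableOn_besselDensity hb (Z ^ 2 * k ^ 2 / 4))).comp_mul_left hZ.ne' using 3 with ω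
  · rw [mul_one, abs_of_pos hZ]
  · rw [← besselClifford_eq_integral_cos hb, sub_add_cancel]
    congr 1
    ring

theorem isPaleyWiener_smoothSymbol {a Z : ℝ} (ha : 1 / 2 < a) (hZ : 0 < Z) (k : ℝ) :
    IsPaleyWiener Z fun ω => (smoothSymbol a Z ω k : ℂ) := by
  convert (isPaleyWiener_besselClifford ha hZ k).const_mul (Real.Gamma a * Z ^ a : ℝ) using 2
  rw [← Complex.ofReal_mul, smoothSymbol]

theorem exists_isPaleyWiener_smoothSymbol {a Z : ℝ} (ha : 0 < a) (hZ : 0 < Z) (k : ℝ) :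
    ∃ p q : ℝ → ℂ, IsPaleyWiener Z p ∧ IsPaleyWiener Z q ∧
      ∀ ω : ℝ, (smoothSymbol a Z ω k : ℂ) = p ω + (ω : ℂ) ^ 2 * q ω := by
  have isPaleyWiener_succ := isPaleyWiener_besselClifford (a := a + 1) (by linarith) hZ k
  have isPaleyWiener_add_two := isPaleyWiener_besselClifford (a := a + 2) (by linarith) hZ k
  refine ⟨_, _, (isPaleyWiener_succ.const_mul (Real.Gamma a * Z ^ a * a : ℝ)).add
    (isPaleyWiener_add_two.const_mul (Real.Gamma a * Z ^ a * (Z ^ 2 * k ^ 2 / 4) : ℝ)),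
    isPaleyWiener_add_two.const_mul (-(Real.Gamma a * Z ^ a * (Z ^ 2 / 4)) : ℝ), fun ω => ?_⟩
  rw [smoothSymbol, besselClifford_recurrence ha]
  norm_cast
  ring

theorem cpow_half_cpow (s c : ℂ) : (s ^ (1 / 2 : ℂ)) ^ c = s ^ (c / 2) := by
  have log_half_im : (Complex.log s * (1 / 2)).im = Complex.arg s / 2 := by
    rw [show Complex.log s * (1 / 2) = Complex.log s / (2 : ℝ) by push_cast; ring,
      Complex.div_ofReal_im, Complex.log_im]
  rw [← Complex.cpow_mul, one_div_mul_eq_div] <;> rw [log_half_im] <;>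
    linarith [Complex.neg_pi_lt_arg s, Complex.arg_le_pi s, Real.pi_pos]

theorem ofReal_mul_cpow {r : ℝ} (hr : 0 < r) {w : ℂ} (hw : w ≠ 0) (c : ℂ) :
    (r * w) ^ c = (r : ℂ) ^ c * w ^ c := by
  have hr' : (r : ℂ) ≠ 0 := Complex.ofReal_ne_zero.2 hr.ne'
  rw [Complex.cpow_def_of_ne_zero (mul_ne_zero hr' hw), Complex.cpow_def_of_ne_zero hr',
    Complex.cpow_def_of_ne_zero hw, Complex.log_ofReal_mul hr hw, ← Complex.ofReal_log hr.le,
    add_mul, Complex.exp_add]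

theorem cpow_neg_half_mul_cpow {s : ℂ} {r : ℝ} (hr : 0 < r) {c : ℂ} (h : s ≠ 0 ∨ c = 0) :
    s ^ (-c / 2) * (r * s ^ (1 / 2 : ℂ)) ^ c = (r : ℂ) ^ c := by
  rcases h with hs | rfl
  · have sqrt_ne_zero : s ^ (1 / 2 : ℂ) ≠ 0 := by simp [Complex.cpow_eq_zero_iff, hs]
    rw [ofReal_mul_cpow hr sqrt_ne_zero, cpow_half_cpow, mul_left_comm, ← Complex.cpow_add _ _ hs,
      neg_div, neg_add_cancel, Complex.cpow_zero, mul_one]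
  · simp

theorem besselJ_eq_cpow_mul_besselClifford (μ : ℝ) {z : ℂ} {x : ℝ} (hz : (z / 2) ^ 2 = -x) :
    besselJ μ z = (z / 2) ^ (μ : ℂ) * besselClifford (1 + μ) x := by
  rw [besselJ, besselClifford, Complex.ofReal_tsum]
  congr 1
  refine tsum_congr fun n => ?_
  rw [pow_mul, hz, show (n : ℂ) + μ + 1 = ((1 + μ + n : ℝ) : ℂ) by push_cast; ring,
    Complex.Gamma_ofReal, div_mul_eq_mul_div, ← mul_pow]
  push_cast
  ring

theorem modeSymbol_eq_smoothSymbol {μ Z ω k : ℝ} (hZ : 0 < Z) (h : ω ^ 2 ≠ k ^ 2 ∨ μ = 0) :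
    modeSymbol μ Z ω k = (smoothSymbol (1 + μ) Z ω k : ℂ) := by
  set s := negMomentumSq ω k with s_def
  have s_eq : s = ((ω ^ 2 - k ^ 2 : ℝ) : ℂ) := by rw [s_def, negMomentumSq]; push_cast; rfl
  have hs : s ≠ 0 ∨ (μ : ℂ) = 0 :=
    h.imp (fun h => by rwa [s_eq, Complex.ofReal_ne_zero, sub_ne_zero]) Complex.ofReal_eq_zero.2
  have argument_eq : s ^ (1 / 2 : ℂ) * Z / 2 = (Z / 2 : ℝ) * s ^ (1 / 2 : ℂ) := by
    push_cast; ring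
  have argument_sq : (s ^ (1 / 2 : ℂ) * Z / 2) ^ 2 = -(Z ^ 2 * (k ^ 2 - ω ^ 2) / 4 : ℝ) := by
    rw [argument_eq, mul_pow, one_div, Complex.cpow_ofNat_inv_pow, s_eq]
    push_cast; ring
  have powers_eq : (2 : ℂ) ^ (μ : ℂ) * (Z * ((Z / 2 : ℝ) : ℂ) ^ (μ : ℂ)) = (Z ^ (1 + μ) : ℝ) := by
    rw [← Complex.ofReal_cpow (by positivity), show (2 : ℂ) = (2 : ℝ) by norm_cast,
      ← Complex.ofReal_cpow zero_le_two, Real.div_rpow hZ.le zero_le_two, Real.rpow_add hZ,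
      Real.rpow_one]
    norm_cast
    field_simp
  rw [modeSymbol, radialMode, besselJ_eq_cpow_mul_besselClifford μ argument_sq, argument_eq,
    smoothSymbol, Complex.ofReal_mul, Complex.ofReal_mul, ← powers_eq, ← Complex.Gamma_ofReal,
    ← cpow_neg_half_mul_cpow (half_pos hZ) hs]
  push_cast
  ring

theorem modeSymbol_eq_zero {μ ω k : ℝ} (hμ : μ ≠ 0) (h : ω ^ 2 = k ^ 2) (Z : ℝ) :
    modeSymbol μ Z ω k = 0 := by
  have momentum_eq_zero : negMomentumSq ω k = 0 := by
    rw [negMomentumSq, sub_eq_zero]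
    exact_mod_cast h
  have exponent_ne_zero : -(μ : ℂ) / 2 ≠ 0 := by simpa using hμ
  rw [modeSymbol, momentum_eq_zero, Complex.zero_cpow exponent_ne_zero, mul_zero, zero_mul]

theorem modeSymbol_eq_ite {μ Z : ℝ} (hZ : 0 < Z) (ω k : ℝ) :
    modeSymbol μ Z ω k =
      if ω ^ 2 = k ^ 2 ∧ μ ≠ 0 then 0 else (smoothSymbol (1 + μ) Z ω k : ℂ) := by
  split_ifs with h
  · exact modeSymbol_eq_zero h.2 h.1 Z
  · exact modeSymbol_eq_smoothSymbol hZ (by tauto)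

theorem modeSymbol_ae_eq_smoothSymbol {μ Z : ℝ} (hZ : 0 < Z) (k : ℝ) :
    ∀ᵐ ω : ℝ, modeSymbol μ Z ω k = (smoothSymbol (1 + μ) Z ω k : ℂ) := by
  filter_upwards [((Set.finite_singleton (-k)).insert k).countable.ae_notMem volume] with ω hω
  refine modeSymbol_eq_smoothSymbol hZ (Or.inl fun h => hω ?_)
  exact sq_eq_sq_iff_eq_or_eq_neg.1 h

/-- The properties of a momentum-space symbol that make its kernel defined, real, and of spacelike
support when the bulk point has radial coordinate `Z`. Each slice `ω ↦ m ω k` is the Fourier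
transform of a distribution of order at most two in `[-Z, Z]`, the shape that
`besselClifford_recurrence` gives. -/
structure IsAdmissibleSymbol (Z : ℝ) (m : ℝ → ℝ → ℂ) : Prop where
  measurable : Measurable fun q : ℝ × ℝ => m q.1 q.2
  im_eq_zero : ∀ ω k, (m ω k).im = 0
  even : ∀ ω k, m (-ω) (-k) = m ω k
  growth : ∀ B : ℝ, ∃ C, ∀ ω k : ℝ, k ^ 2 - ω ^ 2 ≤ B → ‖m ω k‖ ≤ C * ((1 + ω ^ 2) * (1 + k ^ 2))
  exists_isPaleyWiener : ∀ k : ℝ, ∃ p q : ℝ → ℂ, IsPaleyWiener Z p ∧ IsPaleyWiener Z q ∧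
    ∀ᵐ ω : ℝ, m ω k = p ω + (ω : ℂ) ^ 2 * q ω

/-- Each slice `ω ↦ m ω k` is, up to a null set, the Fourier transform of an integrable function
that vanishes off `(-Z, Z)`. For such symbols the kernel vanishes pointwise. -/
def HasPaleyWienerSlices (Z : ℝ) (m : ℝ → ℝ → ℂ) : Prop :=
  ∀ k : ℝ, ∃ s : ℝ → ℂ, IsPaleyWiener Z s ∧ ∀ᵐ ω : ℝ, m ω k = s ω

theorem measurable_modeSymbol {μ Z : ℝ} (hμ : -1 < μ) (hZ : 0 < Z) :
    Measurable fun q : ℝ × ℝ => modeSymbol μ Z q.1 q.2 := by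
  simp only [modeSymbol_eq_ite hZ]
  refine Measurable.ite ?_ measurable_const (Complex.continuous_ofReal.comp
    (continuous_smoothSymbol (by linarith) Z)).measurable
  exact (measurableSet_eq_fun (by fun_prop) (by fun_prop)).inter (MeasurableSet.const (μ ≠ 0))

theorem modeSymbol_growth {μ Z : ℝ} (hμ : -1 < μ) (hZ : 0 < Z) (B : ℝ) :
    ∃ C, ∀ ω k : ℝ, k ^ 2 - ω ^ 2 ≤ B →
      ‖modeSymbol μ Z ω k‖ ≤ C * ((1 + ω ^ 2) * (1 + k ^ 2)) := by
  obtain ⟨C, hC⟩ := smoothSymbol_growth (a := 1 + μ) (by linarith) Z B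
  refine ⟨C, fun ω k hωk => ?_⟩
  have bound := hC ω k hωk
  rw [modeSymbol_eq_ite hZ]
  split_ifs
  · simpa using (abs_nonneg _).trans bound
  · simpa using bound

theorem isAdmissibleSymbol_modeSymbol {μ Z : ℝ} (hμ : -1 < μ) (hZ : 0 < Z) :
    IsAdmissibleSymbol Z (modeSymbol μ Z) where
  measurable := measurable_modeSymbol hμ hZ
  im_eq_zero ω k := by
    rw [modeSymbol_eq_ite hZ]
    split_ifs <;> simp
  even ω k := by simp only [modeSymbol_eq_ite hZ, neg_sq, smoothSymbol]
  growth := modeSymbol_growth hμ hZ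
  exists_isPaleyWiener k := by
    obtain ⟨p, q, hp, hq, slice_eq⟩ :=
      exists_isPaleyWiener_smoothSymbol (a := 1 + μ) (by linarith) hZ k
    exact ⟨p, q, hp, hq,
      (modeSymbol_ae_eq_smoothSymbol hZ k).mono fun ω hω => hω.trans (slice_eq ω)⟩

theorem hasPaleyWienerSlices_modeSymbol {μ Z : ℝ} (hμ : -(1 / 2) < μ) (hZ : 0 < Z) :
    HasPaleyWienerSlices Z (modeSymbol μ Z) := fun k =>
  ⟨_, isPaleyWiener_smoothSymbol (by linarith) hZ k, modeSymbol_ae_eq_smoothSymbol hZ k⟩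

theorem IsAdmissibleSymbol.const_mul_add_const_mul {Z : ℝ} {m m' : ℝ → ℝ → ℂ}
    (hm : IsAdmissibleSymbol Z m) (hm' : IsAdmissibleSymbol Z m') (c c' : ℝ) :
    IsAdmissibleSymbol Z fun ω k => (c : ℂ) * m ω k + (c' : ℂ) * m' ω k where
  measurable := (hm.measurable.const_mul _).add (hm'.measurable.const_mul _)
  im_eq_zero ω k := by simp [hm.im_eq_zero, hm'.im_eq_zero]
  even ω k := by rw [hm.even, hm'.even]
  growth B := by
    obtain ⟨C, hC⟩ := hm.growth B
    obtain ⟨C', hC'⟩ := hm'.growth B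
    refine ⟨|c| * C + |c'| * C', fun ω k hωk => (norm_add_le _ _).trans ?_⟩
    rw [norm_mul, norm_mul, Complex.norm_real, Complex.norm_real, Real.norm_eq_abs,
      Real.norm_eq_abs, add_mul, mul_assoc, mul_assoc]
    gcongr
    · exact hC ω k hωk
    · exact hC' ω k hωk
  exists_isPaleyWiener k := by
    obtain ⟨p, q, hp, hq, slice_eq⟩ := hm.exists_isPaleyWiener k
    obtain ⟨p', q', hp', hq', slice_eq'⟩ := hm'.exists_isPaleyWiener k
    refine ⟨_, _, (hp.const_mul c).add (hp'.const_mul c'), (hq.const_mul c).add (hq'.const_mul c'),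
      ?_⟩
    filter_upwards [slice_eq, slice_eq'] with ω hω hω'
    rw [hω, hω']
    ring

theorem HasPaleyWienerSlices.const_mul_add_const_mul {Z : ℝ} {m m' : ℝ → ℝ → ℂ}
    (hm : HasPaleyWienerSlices Z m) (hm' : HasPaleyWienerSlices Z m') (c c' : ℂ) :
    HasPaleyWienerSlices Z fun ω k => c * m ω k + c' * m' ω k := fun k => by
  obtain ⟨s, hs, slice_eq⟩ := hm k
  obtain ⟨s', hs', slice_eq'⟩ := hm' k
  refine ⟨_, (hs.const_mul c).add (hs'.const_mul c'), ?_⟩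
  filter_upwards [slice_eq, slice_eq'] with ω hω hω'
  rw [hω, hω']

theorem isAdmissibleSymbol_robinSymbol {ν Z : ℝ} (hν : |ν| < 1) (hZ : 0 < Z) (γ : ℝ) :
    IsAdmissibleSymbol Z (robinSymbol ν γ Z) :=
  (isAdmissibleSymbol_modeSymbol (abs_lt.1 hν).1 hZ).const_mul_add_const_mul
    (isAdmissibleSymbol_modeSymbol (neg_lt_neg (abs_lt.1 hν).2) hZ) _ _

theorem hasPaleyWienerSlices_robinSymbol {ν Z : ℝ} (hν : |ν| < 1 / 2) (hZ : 0 < Z) (γ : ℝ) :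
    HasPaleyWienerSlices Z (robinSymbol ν γ Z) :=
  (hasPaleyWienerSlices_modeSymbol (abs_lt.1 hν).1 hZ).const_mul_add_const_mul
    (hasPaleyWienerSlices_modeSymbol (neg_lt_neg (abs_lt.1 hν).2) hZ) _ _

/-! ### Plane-wave transforms of test functions -/

theorem exists_one_add_norm_pow_mul_norm_le {E F : Type*} [NormedAddCommGroup E] [NormedSpace ℝ E]
    [NormedAddCommGroup F] [NormedSpace ℝ F] (g : 𝓢(E, F)) (n : ℕ) :
    ∃ C, ∀ x, (1 + ‖x‖) ^ n * ‖g x‖ ≤ C :=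
  ⟨_, fun x => by
    simpa only [norm_iteratedFDeriv_zero] using
      g.one_add_le_sup_seminorm_apply (𝕜 := ℝ) (m := (n, 0)) le_rfl le_rfl x⟩

theorem norm_planeWave (T' X' ω k : ℝ) (p : ℝ × ℝ) : ‖planeWave T' X' ω k p‖ = 1 := by
  rw [planeWave, show -Complex.I * ω * (T' - p.1) + Complex.I * k * (X' - p.2) =
    ((-ω * (T' - p.1) + k * (X' - p.2) : ℝ) : ℂ) * Complex.I by push_cast; ring,
    Complex.norm_exp_ofReal_mul_I]

theorem exists_waveTransform_eq_planeWave_mul (f : 𝓢(ℝ × ℝ, ℂ)) :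
    ∃ g : 𝓢(WithLp 2 (ℝ × ℝ), ℂ), ∀ T' X' ω k : ℝ, waveTransform T' X' f ω k =
      planeWave T' X' ω k 0 * g (WithLp.toLp 2 (-ω / (2 * Real.pi), k / (2 * Real.pi))) := by
  refine ⟨FourierTransform.fourier (SchwartzMap.compCLMOfContinuousLinearEquiv ℝ
    (WithLp.prodContinuousLinearEquiv 2 ℝ ℝ ℝ) f), fun T' X' ω k => ?_⟩
  rw [SchwartzMap.fourier_coe, Real.fourier_eq', waveTransform, ← integral_const_mul,
    ← (WithLp.volume_preserving_ofLp ℝ ℝ).integral_comp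
      (MeasurableEquiv.toLp 2 (ℝ × ℝ)).symm.measurableEmbedding]
  refine integral_congr_ae (ae_of_all _ fun v => ?_)
  simp only [smul_eq_mul, SchwartzMap.compCLMOfContinuousLinearEquiv_apply, Function.comp,
    WithLp.prod_inner_apply, planeWave, ← mul_assoc, ← Complex.exp_add]
  congr 2
  have := Real.pi_ne_zero
  simp only [neg_mul, WithLp.ofLp_fst, WithLp.ofLp_snd, Prod.fst_zero, Complex.ofReal_zero,
    sub_zero, Prod.snd_zero, RCLike.inner_apply, Real.ringHom_apply, Complex.ofReal_neg,
    Complex.ofReal_mul, Complex.ofReal_ofNat, Complex.ofReal_add, Complex.ofReal_div]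
  field_simp
  ring

theorem continuous_waveTransform (T' X' : ℝ) (f : 𝓢(ℝ × ℝ, ℂ)) :
    Continuous fun q : ℝ × ℝ => waveTransform T' X' f q.1 q.2 := by
  obtain ⟨g, hg⟩ := exists_waveTransform_eq_planeWave_mul f
  simp only [hg, planeWave]
  have continuous_momentum : Continuous fun q : ℝ × ℝ =>
      (WithLp.toLp 2 (-q.1 / (2 * Real.pi), q.2 / (2 * Real.pi)) : WithLp 2 (ℝ × ℝ)) :=
    (WithLp.prodContinuousLinearEquiv 2 ℝ ℝ ℝ).symm.continuous.comp
      (f := fun q : ℝ × ℝ => (-q.1 / (2 * Real.pi), q.2 / (2 * Real.pi))) (by fun_prop)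
  exact (by fun_prop : Continuous _).mul (g.continuous.comp continuous_momentum)

theorem one_add_sq_le_of_abs_div_two_pi_le {x r : ℝ} (h : |x / (2 * Real.pi)| ≤ r) :
    1 + x ^ 2 ≤ (2 * Real.pi * (1 + r)) ^ 2 := by
  rw [abs_div, abs_of_pos Real.two_pi_pos, div_le_iff₀' Real.two_pi_pos] at h
  calc 1 + x ^ 2 = 1 + |x| ^ 2 := by rw [sq_abs]
    _ ≤ (1 + |x|) ^ 2 := by linarith [abs_nonneg x]
    _ ≤ (2 * Real.pi * (1 + r)) ^ 2 := by
        gcongr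
        linarith [Real.pi_gt_three]

theorem waveTransform_decay (f : 𝓢(ℝ × ℝ, ℂ)) (n : ℕ) : ∃ C, ∀ T' X' ω k : ℝ,
    ((1 + ω ^ 2) * (1 + k ^ 2)) ^ n * ‖waveTransform T' X' f ω k‖ ≤ C := by
  obtain ⟨g, hg⟩ := exists_waveTransform_eq_planeWave_mul f
  obtain ⟨C, hC⟩ := exists_one_add_norm_pow_mul_norm_le g (4 * n)
  refine ⟨(2 * Real.pi) ^ (4 * n) * C, fun T' X' ω k => ?_⟩
  set ξ : WithLp 2 (ℝ × ℝ) := WithLp.toLp 2 (-ω / (2 * Real.pi), k / (2 * Real.pi))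
  have frequency_le : 1 + (-ω) ^ 2 ≤ (2 * Real.pi * (1 + ‖ξ‖)) ^ 2 :=
    one_add_sq_le_of_abs_div_two_pi_le (WithLp.norm_fst_le _ ξ)
  have wavenumber_le : 1 + k ^ 2 ≤ (2 * Real.pi * (1 + ‖ξ‖)) ^ 2 :=
    one_add_sq_le_of_abs_div_two_pi_le (WithLp.norm_snd_le _ ξ)
  rw [neg_sq] at frequency_le
  rw [hg, norm_mul, norm_planeWave, one_mul]
  calc ((1 + ω ^ 2) * (1 + k ^ 2)) ^ n * ‖g ξ‖
      ≤ ((2 * Real.pi * (1 + ‖ξ‖)) ^ 2 * (2 * Real.pi * (1 + ‖ξ‖)) ^ 2) ^ n * ‖g ξ‖ := by gcongr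
    _ = (2 * Real.pi) ^ (4 * n) * ((1 + ‖ξ‖) ^ (4 * n) * ‖g ξ‖) := by
        rw [← pow_add, ← pow_mul, mul_pow, mul_assoc]
    _ ≤ (2 * Real.pi) ^ (4 * n) * C := by gcongr; exact hC ξ

theorem norm_mul_le_of_growth_of_decay {z w : ℂ} {C D W : ℝ} (hW : 0 < W) (hz : ‖z‖ ≤ C * W)
    (hw : W ^ 2 * ‖w‖ ≤ D) : ‖z * w‖ ≤ C * D * W⁻¹ := by
  rw [norm_mul, ← div_eq_mul_inv, le_div_iff₀ hW]
  have product_le : ‖z‖ * (W ^ 2 * ‖w‖) ≤ C * W * D :=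
    mul_le_mul hz hw (by positivity) ((norm_nonneg z).trans hz)
  refine le_of_mul_le_mul_right ?_ hW
  linarith

theorem integrable_inv_one_add_sq_mul_one_add_sq :
    Integrable fun q : ℝ × ℝ => ((1 + q.1 ^ 2) * (1 + q.2 ^ 2))⁻¹ := by
  simp only [mul_inv]
  exact integrable_inv_one_add_sq.mul_prod integrable_inv_one_add_sq

theorem conj_planeWave (T' X' ω k : ℝ) (p : ℝ × ℝ) :
    (starRingEnd ℂ) (planeWave T' X' ω k p) = planeWave T' X' (-ω) (-k) p := by
  rw [planeWave, planeWave, ← Complex.exp_conj]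
  simp

theorem conj_waveTransform (T' X' : ℝ) {f : 𝓢(ℝ × ℝ, ℂ)} (hf : ∀ p, (f p).im = 0) (ω k : ℝ) :
    (starRingEnd ℂ) (waveTransform T' X' f ω k) = waveTransform T' X' f (-ω) (-k) := by
  rw [waveTransform, waveTransform, ← integral_conj]
  refine integral_congr_ae (ae_of_all _ fun p => ?_)
  simp only [map_mul, conj_planeWave, Complex.conj_eq_iff_im.2 (hf p)]

theorem im_integral_eq_zero {g : ℝ → ℂ} (hg : ∀ k, (starRingEnd ℂ) (g k) = g (-k)) :
    (∫ k, g k).im = 0 := by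
  rw [← Complex.conj_eq_iff_im, ← integral_conj]
  simp only [hg]
  exact integral_neg_eq_self g volume

theorem conj_integral_of_conj_eq {g h : ℝ → ℂ} (hgh : ∀ ω, (starRingEnd ℂ) (g ω) = h (-ω)) :
    (starRingEnd ℂ) (∫ ω, g ω) = ∫ ω, h ω := by
  rw [← integral_conj, ← integral_neg_eq_self h]
  simp only [hgh]

theorem conj_intervalIntegral_of_conj_eq {g h : ℝ → ℂ}
    (hgh : ∀ ω, (starRingEnd ℂ) (g ω) = h (-ω)) (R : ℝ) :
    (starRingEnd ℂ) (∫ ω in (-R)..R, g ω) = ∫ ω in (-R)..R, h ω := by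
  rw [← intervalIntegral.intervalIntegral_conj]
  simp only [hgh, intervalIntegral.integral_comp_neg, neg_neg]

namespace IsAdmissibleSymbol

variable {Z : ℝ} {m : ℝ → ℝ → ℂ}

theorem integrable_mul_waveTransform (hm : IsAdmissibleSymbol Z m) (T' X' : ℝ)
    (f : 𝓢(ℝ × ℝ, ℂ)) (k : ℝ) : Integrable fun ω : ℝ => m ω k * waveTransform T' X' f ω k := by
  obtain ⟨C, hC⟩ := hm.growth (k ^ 2)
  obtain ⟨D, hD⟩ := waveTransform_decay f 2
  have measurable_product := hm.measurable.mul (continuous_waveTransform T' X' f).measurable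
  refine (integrable_inv_one_add_sq.const_mul (C * D * (1 + k ^ 2)⁻¹)).mono'
    (measurable_product.comp measurable_prodMk_right).aestronglyMeasurable
    (ae_of_all _ fun ω => ?_)
  calc ‖m ω k * waveTransform T' X' f ω k‖ ≤ C * D * ((1 + ω ^ 2) * (1 + k ^ 2))⁻¹ :=
        norm_mul_le_of_growth_of_decay (by positivity)
          (hC ω k (sub_le_self _ (sq_nonneg ω))) (hD T' X' ω k)
    _ = C * D * (1 + k ^ 2)⁻¹ * (1 + ω ^ 2)⁻¹ := by rw [mul_inv]; ring

theorem integrable_prod_mul_waveTransform (hm : IsAdmissibleSymbol Z m) {T' X' B : ℝ}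
    {f : 𝓢(ℝ × ℝ, ℂ)} (hf : ∀ ω k : ℝ, B < k ^ 2 - ω ^ 2 → waveTransform T' X' f ω k = 0) :
    Integrable fun q : ℝ × ℝ => m q.1 q.2 * waveTransform T' X' f q.1 q.2 := by
  obtain ⟨C, hC⟩ := hm.growth B
  obtain ⟨D, hD⟩ := waveTransform_decay f 2
  refine (integrable_inv_one_add_sq_mul_one_add_sq.const_mul (|C| * D)).mono'
    (hm.measurable.mul (continuous_waveTransform T' X' f).measurable).aestronglyMeasurable
    (ae_of_all _ fun q => ?_)
  rcases le_or_gt (q.2 ^ 2 - q.1 ^ 2) B with hq | hq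
  · refine norm_mul_le_of_growth_of_decay (by positivity) ((hC _ _ hq).trans ?_) (hD T' X' q.1 q.2)
    gcongr
    exact le_abs_self C
  · have D_nonneg : 0 ≤ D := le_trans (by positivity) (hD T' X' 0 0)
    rw [hf _ _ hq, mul_zero, norm_zero]
    positivity

theorem isDefinedKernel (hm : IsAdmissibleSymbol Z m) (T' X' : ℝ) : IsDefinedKernel m T' X' :=
  fun f _ hf =>
    have integrable_prod := hm.integrable_prod_mul_waveTransform hf
    ⟨⟨hm.integrable_mul_waveTransform T' X' f, integrable_prod.integral_prod_right⟩,
      integrable_prod⟩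

theorem conj (hm : IsAdmissibleSymbol Z m) (ω k : ℝ) :
    (starRingEnd ℂ) (m ω k) = m (-ω) (-k) := by
  rw [hm.even, Complex.conj_eq_iff_im.2 (hm.im_eq_zero ω k)]

theorem im_kernelPairing_eq_zero (hm : IsAdmissibleSymbol Z m) (T' X' : ℝ) {f : 𝓢(ℝ × ℝ, ℂ)}
    (hf : ∀ p, (f p).im = 0) : (kernelPairing m T' X' f).im = 0 := by
  rw [kernelPairing, Complex.im_ofReal_mul, im_integral_eq_zero, mul_zero]
  exact fun k => conj_integral_of_conj_eq fun ω => by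
    rw [map_mul, hm.conj, conj_waveTransform T' X' hf]

theorem im_eq_zero_of_hasKernelValue (hm : IsAdmissibleSymbol Z m) {T' X' : ℝ} {p : ℝ × ℝ} {c : ℂ}
    (hc : HasKernelValue m T' X' p c) : c.im = 0 := by
  obtain ⟨g, hg, -, rfl⟩ := hc
  rw [Complex.im_ofReal_mul, im_integral_eq_zero, mul_zero]
  refine fun k => tendsto_nhds_unique ((Complex.continuous_conj.tendsto _).comp (hg k))
    ((hg (-k)).congr fun R => Eq.symm ?_)
  exact conj_intervalIntegral_of_conj_eq
    (fun ω => by rw [map_mul, conj_planeWave, hm.conj]) R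

theorem isRealKernel (hm : IsAdmissibleSymbol Z m) (T' X' : ℝ) : IsRealKernel m T' X' :=
  ⟨fun _ _ hf => hm.im_kernelPairing_eq_zero T' X' hf,
    fun _ _ hc => hm.im_eq_zero_of_hasKernelValue hc⟩

end IsAdmissibleSymbol

/-! ### Support of the kernel -/

theorem integrable_pow_mul_waveTransform (T' X' : ℝ) (f : 𝓢(ℝ × ℝ, ℂ)) (k : ℝ) (n : ℕ) :
    Integrable fun ω : ℝ => (ω : ℂ) ^ n * waveTransform T' X' f ω k := by
  obtain ⟨C, hC⟩ := waveTransform_decay f (n + 1)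
  have continuous_slice : Continuous fun ω : ℝ => waveTransform T' X' f ω k :=
    (continuous_waveTransform T' X' f).comp (f := fun ω : ℝ => (ω, k)) (by fun_prop)
  refine (integrable_inv_one_add_sq.const_mul C).mono'
    (by fun_prop : Continuous _).aestronglyMeasurable (ae_of_all _ fun ω => ?_)
  have abs_le : |ω| ≤ 1 + ω ^ 2 := by
    rw [← sq_abs]
    linarith [sq_nonneg (|ω| - 1), abs_nonneg ω]
  have weight_le : 1 + ω ^ 2 ≤ (1 + ω ^ 2) * (1 + k ^ 2) :=
    le_mul_of_one_le_right (by positivity) (by linarith [sq_nonneg k])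
  rw [← div_eq_mul_inv, le_div_iff₀ (by positivity), norm_mul, norm_pow, Complex.norm_real,
    Real.norm_eq_abs]
  calc |ω| ^ n * ‖waveTransform T' X' f ω k‖ * (1 + ω ^ 2)
      ≤ (1 + ω ^ 2) ^ n * ‖waveTransform T' X' f ω k‖ * (1 + ω ^ 2) := by gcongr
    _ = (1 + ω ^ 2) ^ (n + 1) * ‖waveTransform T' X' f ω k‖ := by ring
    _ ≤ ((1 + ω ^ 2) * (1 + k ^ 2)) ^ (n + 1) * ‖waveTransform T' X' f ω k‖ := by gcongr
    _ ≤ C := hC T' X' ω k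

theorem integrable_waveTransform (T' X' : ℝ) (f : 𝓢(ℝ × ℝ, ℂ)) (k : ℝ) :
    Integrable fun ω : ℝ => waveTransform T' X' f ω k := by
  simpa using integrable_pow_mul_waveTransform T' X' f k 0

/-- The partial Fourier transform of a test function in the boundary coordinate `X`. -/
def spatialTransform (X' : ℝ) (f : 𝓢(ℝ × ℝ, ℂ)) (k T : ℝ) : ℂ :=
  ∫ X : ℝ, Complex.exp (Complex.I * k * (X' - X)) * f (T, X)

theorem continuous_spatialTransform (X' : ℝ) (f : 𝓢(ℝ × ℝ, ℂ)) (k : ℝ) :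
    Continuous (spatialTransform X' f k) := by
  obtain ⟨C, hC⟩ := exists_one_add_norm_pow_mul_norm_le f 2
  refine continuous_of_dominated (bound := fun X => C * (1 + X ^ 2)⁻¹) (fun T => ?_)
    (fun T => ae_of_all _ fun X => ?_) (integrable_inv_one_add_sq.const_mul C)
    (ae_of_all _ fun X => ?_)
  · exact (Continuous.mul (by fun_prop) (f.continuous.comp (by fun_prop))).aestronglyMeasurable
  · have norm_exp_eq_one : ‖Complex.exp (Complex.I * k * (X' - X))‖ = 1 := by
      exact_mod_cast norm_exp_I_mul_mul k (X' - X)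
    have weight_le : 1 + X ^ 2 ≤ (1 + ‖(T, X)‖) ^ 2 := by
      have : |X| ≤ ‖(T, X)‖ := norm_snd_le (T, X)
      calc 1 + X ^ 2 ≤ (1 + |X|) ^ 2 := by rw [← sq_abs]; linarith [abs_nonneg X]
        _ ≤ (1 + ‖(T, X)‖) ^ 2 := by gcongr
    rw [norm_mul, norm_exp_eq_one, one_mul, ← div_eq_mul_inv, le_div_iff₀' (by positivity)]
    exact (mul_le_mul_of_nonneg_right weight_le (norm_nonneg _)).trans (hC (T, X))
  · exact continuous_const.mul (f.continuous.comp (by fun_prop))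

theorem integrable_planeWave_mul (T' X' : ℝ) (f : 𝓢(ℝ × ℝ, ℂ)) (ω k : ℝ) :
    Integrable fun p : ℝ × ℝ => planeWave T' X' ω k p * f p := by
  have continuous_planeWave : Continuous (planeWave T' X' ω k) := by
    unfold planeWave
    fun_prop
  exact (f.integrable (μ := volume)).bdd_mul continuous_planeWave.aestronglyMeasurable
    (ae_of_all _ fun p => (norm_planeWave T' X' ω k p).le)

theorem integrable_spatialTransform (X' : ℝ) (f : 𝓢(ℝ × ℝ, ℂ)) (k : ℝ) :
    Integrable (spatialTransform X' f k) :=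
  (integrable_planeWave_mul 0 X' f 0 k).integral_prod_left.congr <| ae_of_all _ fun T => by
    simp [planeWave, spatialTransform]

theorem waveTransform_eq_angularFourier (T' X' : ℝ) (f : 𝓢(ℝ × ℝ, ℂ)) (ω k : ℝ) :
    waveTransform T' X' f ω k = angularFourier (fun t => spatialTransform X' f k (t + T')) ω := by
  rw [angularFourier_comp_add_right, angularFourier, waveTransform, Measure.volume_eq_prod,
    integral_prod _ (integrable_planeWave_mul T' X' f ω k), ← integral_const_mul]
  refine integral_congr_ae (ae_of_all _ fun T => ?_)
  simp only [spatialTransform]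
  rw [← integral_const_mul, ← integral_const_mul]
  refine integral_congr_ae (ae_of_all _ fun X => ?_)
  simp only [planeWave, ← mul_assoc, ← Complex.exp_add]
  congr 2
  ring

theorem angularFourier_waveTransform (T' X' : ℝ) (f : 𝓢(ℝ × ℝ, ℂ)) (k y : ℝ) :
    angularFourier (fun ω => waveTransform T' X' f ω k) y =
      2 * Real.pi * spatialTransform X' f k (-y + T') := by
  have waveTransform_eq := funext fun ω => waveTransform_eq_angularFourier T' X' f ω k
  have transform_integrable := integrable_waveTransform T' X' f k
  rw [waveTransform_eq] at transform_integrable ⊢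
  exact angularFourier_angularFourier
    ((continuous_spatialTransform X' f k).comp (continuous_add_const T'))
    ((integrable_spatialTransform X' f k).comp_add_right T') transform_integrable y

/-- The boundary points whose time differs from `T'` by more than `Z`: the open set on which the
kernel of a bulk point at `(T', Z)` vanishes. -/
def timeGapRegion (T' Z : ℝ) : Set (ℝ × ℝ) := {p | Z < |T' - p.1|}

theorem isOpen_timeGapRegion (T' Z : ℝ) : IsOpen (timeGapRegion T' Z) :=
  isOpen_lt continuous_const (by fun_prop)

theorem timelikeRegion_union_lightlikeRegion_subset (T' X' Z : ℝ) :
    timelikeRegion T' X' Z ∪ lightlikeRegion T' X' Z ⊆ timeGapRegion T' Z := by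
  intro p hp
  have sq_lt : Z ^ 2 < (T' - p.1) ^ 2 := by
    rcases hp with timelike | ⟨lightlike, hne⟩
    · have : (X' - p.2) ^ 2 + Z ^ 2 - (T' - p.1) ^ 2 < 0 := timelike
      linarith [sq_nonneg (X' - p.2)]
    · rw [boundaryInterval] at lightlike
      linarith [sq_pos_of_ne_zero (sub_ne_zero.2 hne.symm)]
  exact (le_abs_self Z).trans_lt (sq_lt_sq.1 sq_lt)

theorem angularFourier_waveTransform_eq_zero {T' Z : ℝ} (X' : ℝ) {f : 𝓢(ℝ × ℝ, ℂ)}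
    (hf : tsupport (f : ℝ × ℝ → ℂ) ⊆ timeGapRegion T' Z) (k : ℝ) {y : ℝ}
    (hy : y ∈ Set.Ioo (-Z) Z) : angularFourier (fun ω => waveTransform T' X' f ω k) y = 0 := by
  have slice_eq_zero (X : ℝ) : f (-y + T', X) = 0 := by
    by_contra hne
    have gap : Z < |T' - (-y + T')| := hf (subset_tsupport _ hne)
    rw [sub_add_cancel_right, neg_neg] at gap
    exact gap.not_ge (abs_lt.2 hy).le
  simp [angularFourier_waveTransform, spatialTransform, slice_eq_zero]

theorem angularFourier_sq_mul_waveTransform_eq_zero {T' Z : ℝ} (X' : ℝ) {f : 𝓢(ℝ × ℝ, ℂ)}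
    (hf : tsupport (f : ℝ × ℝ → ℂ) ⊆ timeGapRegion T' Z) (k : ℝ) {y : ℝ}
    (hy : y ∈ Set.Ioo (-Z) Z) :
    angularFourier (fun ω => (ω : ℂ) ^ 2 * waveTransform T' X' f ω k) y = 0 := by
  have integrable_one := integrable_pow_mul_waveTransform T' X' f k 1
  have integrable_two := integrable_pow_mul_waveTransform T' X' f k 2
  simp only [pow_one, pow_two, mul_assoc] at integrable_one integrable_two ⊢
  refine angularFourier_mul_eq_zero integrable_one integrable_two isOpen_Ioo (fun u hu => ?_) hy
  exact angularFourier_mul_eq_zero (integrable_waveTransform T' X' f k) integrable_one isOpen_Ioo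
    (fun v hv => angularFourier_waveTransform_eq_zero X' hf k hv) hu

section Vanishing

variable {Z : ℝ} {m : ℝ → ℝ → ℂ}

theorem IsAdmissibleSymbol.integral_mul_waveTransform_eq_zero (hm : IsAdmissibleSymbol Z m)
    {T' : ℝ} (X' : ℝ) {f : 𝓢(ℝ × ℝ, ℂ)}
    (hf : tsupport (f : ℝ × ℝ → ℂ) ⊆ timeGapRegion T' Z) (k : ℝ) :
    ∫ ω : ℝ, m ω k * waveTransform T' X' f ω k = 0 := by
  obtain ⟨p, q, hp, hq, slice_eq⟩ := hm.exists_isPaleyWiener k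
  have integrable_zero := integrable_waveTransform T' X' f k
  have integrable_two := integrable_pow_mul_waveTransform T' X' f k 2
  calc ∫ ω : ℝ, m ω k * waveTransform T' X' f ω k
      = ∫ ω : ℝ, (p ω * waveTransform T' X' f ω k +
          q ω * ((ω : ℂ) ^ 2 * waveTransform T' X' f ω k)) := by
        refine integral_congr_ae (slice_eq.mono fun ω hω => ?_)
        simp only [hω]
        ring
    _ = (∫ ω : ℝ, p ω * waveTransform T' X' f ω k) +
          ∫ ω : ℝ, q ω * ((ω : ℂ) ^ 2 * waveTransform T' X' f ω k) :=
        integral_add (hp.integrable_mul integrable_zero) (hq.integrable_mul integrable_two)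
    _ = 0 := by
        rw [hp.integral_mul_eq_zero integrable_zero
            fun y hy => angularFourier_waveTransform_eq_zero X' hf k hy,
          hq.integral_mul_eq_zero integrable_two
            fun y hy => angularFourier_sq_mul_waveTransform_eq_zero X' hf k hy, add_zero]

theorem IsAdmissibleSymbol.kernelVanishesOn_timeGapRegion (hm : IsAdmissibleSymbol Z m)
    (T' X' : ℝ) : KernelVanishesOn m T' X' (timeGapRegion T' Z) := fun f hf => by
  have slice_integral_eq_zero := hm.integral_mul_waveTransform_eq_zero X' hf
  refine ⟨⟨hm.integrable_mul_waveTransform T' X' f, ?_⟩, ?_⟩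
  · simp only [slice_integral_eq_zero]
    exact integrable_zero _ _ _
  · simp [kernelPairing, slice_integral_eq_zero]

theorem IsAdmissibleSymbol.hasSpacelikeSupport (hm : IsAdmissibleSymbol Z m) (T' X' : ℝ) :
    HasSpacelikeSupport m T' X' Z :=
  ⟨timeGapRegion T' Z, isOpen_timeGapRegion T' Z,
    timelikeRegion_union_lightlikeRegion_subset T' X' Z, hm.kernelVanishesOn_timeGapRegion T' X'⟩

theorem planeWave_eq_mul (T' X' ω k : ℝ) (p : ℝ × ℝ) :
    planeWave T' X' ω k p = Complex.exp (Complex.I * k * (X' - p.2)) *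
      Complex.exp (-Complex.I * ω * (T' - p.1 : ℝ)) := by
  rw [planeWave, add_comm, Complex.exp_add, Complex.ofReal_sub]

theorem HasPaleyWienerSlices.hasKernelValue_zero (hm : HasPaleyWienerSlices Z m) {T' : ℝ} (X' : ℝ)
    {p : ℝ × ℝ} (hp : p ∈ timeGapRegion T' Z) : HasKernelValue m T' X' p 0 := by
  refine ⟨fun _ => 0, fun k => ?_, integrable_zero _ _ _, by simp⟩
  obtain ⟨s, hs, slice_eq⟩ := hm k
  have tendsto_zero := (hs.tendsto_intervalIntegral_exp_mul hp).const_mul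
    (Complex.exp (Complex.I * k * (X' - p.2)))
  rw [mul_zero] at tendsto_zero
  refine tendsto_zero.congr fun R => ?_
  rw [← intervalIntegral.integral_const_mul]
  refine intervalIntegral.integral_congr_ae (slice_eq.mono fun ω hω _ => ?_)
  rw [hω, planeWave_eq_mul]
  ring

theorem HasPaleyWienerSlices.vanishesPointwise (hm : HasPaleyWienerSlices Z m) (T' X' : ℝ) :
    VanishesPointwise m T' X' Z := fun _ hp =>
  hm.hasKernelValue_zero X' (timelikeRegion_union_lightlikeRegion_subset T' X' Z hp)

end Vanishing

end

theorem mainTheorem2 (T' X' Z' : ℝ) (hZ : 0 < Z') :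
    (∀ ν : ℝ, 0 ≤ ν →
      IsDefinedKernel (dirichletSymbol ν Z') T' X' ∧
      IsRealKernel (dirichletSymbol ν Z') T' X' ∧
      HasSpacelikeSupport (dirichletSymbol ν Z') T' X' Z' ∧
      VanishesPointwise (dirichletSymbol ν Z') T' X' Z') ∧
    (∀ ν γ : ℝ, 0 < ν → ν < 1 →
      IsDefinedKernel (robinSymbol ν γ Z') T' X' ∧
      IsRealKernel (robinSymbol ν γ Z') T' X' ∧
      HasSpacelikeSupport (robinSymbol ν γ Z') T' X' Z' ∧
      (ν < 1 / 2 → VanishesPointwise (robinSymbol ν γ Z') T' X' Z')) := by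
  refine ⟨fun ν hν => ?_, fun ν γ hν hν_lt_one => ?_⟩
  · have admissible : IsAdmissibleSymbol Z' (dirichletSymbol ν Z') :=
      isAdmissibleSymbol_modeSymbol (by linarith) hZ
    have slices : HasPaleyWienerSlices Z' (dirichletSymbol ν Z') :=
      hasPaleyWienerSlices_modeSymbol (by linarith) hZ
    exact ⟨admissible.isDefinedKernel T' X', admissible.isRealKernel T' X',
      admissible.hasSpacelikeSupport T' X', slices.vanishesPointwise T' X'⟩
  · have admissible : IsAdmissibleSymbol Z' (robinSymbol ν γ Z') :=
      isAdmissibleSymbol_robinSymbol (abs_lt.2 ⟨by linarith, hν_lt_one⟩) hZ γ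
    refine ⟨admissible.isDefinedKernel T' X', admissible.isRealKernel T' X',
      admissible.hasSpacelikeSupport T' X', fun hν_lt_half => ?_⟩
    exact (hasPaleyWienerSlices_robinSymbol (abs_lt.2 ⟨by linarith, hν_lt_half⟩) hZ γ)
      |>.vanishesPointwise T' X'
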